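/- Let $\Sigma\subset\mathbb{R}^3$ be a compact smooth surface with (possibly empty) smooth boundary, oriented by a unit normal $\mathbf n$; let $d\sigma$ and $dl$ denote surface area and arc length, and let $\boldsymbol\tau$ be the unit tangent of $\partial\Sigma$ such that $\mathbf n\times\boldsymbol\tau$ points into $\Sigma$. In positively oriented local coordinates $(x^1,x^2)$ put $\mathbf g_i=\partial\boldsymbol\Sigma/\partial x^i$, where $\boldsymbol\Sigma$ is the position vector, $g_{ij}=\mathbf g_i\cdot\mathbf g_j$, $[g^{ij}]=[g_{ij}]^{-1}$, $\mathbf g^i=g^{ij}\mathbf g_j$, $b_{ij}=\frac{\partial\mathbf g_i}{\partial x^j}\cdot\mathbf n$, $b^i_j=g^{ik}b_{kj}$ (summation convention), and let $\mathbf K=b_{ij}\,\mathbf g^i\otimes\mathbf g^j$ be the curvature tensor and $K_G=\det[b_{ij}]/\det[g_{ij}]=\det[b^i_j]$ the Gaussian curvature. Assume that $\mathbf K$ is nonsingular, i.e. $\det[b^i_j]\neq0$, at every point of $\Sigma$, and set $$\hat{\mathbf L}:=K_G\mathbf K^{-1}=\hat L^{ij}\,\mathbf g_i\otimes\mathbf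 g_j,\qquad \overset{\Sigma}{\overline{\nabla}}:=\hat L^{ij}\,\mathbf g_i\,\frac{\partial}{\partial x^j},$$ where $\mathbf K^{-1}$ is the inverse of $\mathbf K$ on the tangent plane. Let $\boldsymbol\Phi$ be a continuously differentiable (up to the boundary) field on $\Sigma$ with values in a finite-dimensional real vector space $V$ (for instance the space of tensors of any fixed order on $\mathbb{R}^3$), and let $\circ:\mathbb{R}^3\times V\to W$ be any bilinear operation into a finite-dimensional real vector space $W$ (for instance a tensor, dot or cross product). Then both integrals below exist and $$\oint_{\partial\Sigma}(\boldsymbol\tau\cdot\mathbf K)\circ\boldsymbol\Phi\,dl=\int_\Sigma\bigl(\mathbf n\times\overset{\Sigma}{\overline{\nabla}}\bigr)\circ\boldsymbol\Phi\,d\sigma,\qquad\text{where}\quad \bigl(\mathbf n\times\overset{\Sigma}{\overline{\nabla}}\bigr)\circ\boldsymbol\Phi=\hat L^{ij}\,(\mathbf n\times\mathbf g_i)\circ\frac{\partial\boldsymbol\Phi}{\partial x^j}.$$ -/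

import Mathlib

open MeasureTheory
open scoped ContDiff

noncomputable section

namespace SurfaceCalculus

/-- The parameter plane. -/
abbrev E2 : Type := EuclideanSpace ℝ (Fin 2)

/-- Euclidean three-space. -/
abbrev E3 : Type := EuclideanSpace ℝ (Fin 3)

/-- The cross product of Euclidean three-space. -/
def cross (a b : E3) : E3 := WithLp.toLp 2 (crossProduct a.ofLp b.ofLp)

/-- A second-order tensor `T` is represented by the linear map `v ↦ v · T`; the dyad `a ⊗ b`
is therefore `v ↦ (v · a) b`. -/
def dyad (a b : E3) : E3 →ₗ[ℝ] E3 := (innerₗ E3 a).smulRight b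

/-- The closed half-plane `x² ≥ 0`, the local model of a surface with boundary. -/
def halfPlane : Set E2 := {x | 0 ≤ x 1}

/-- A smooth regular local parametrization of a subset `S` of three-space: a smooth map on an
open set `dom` of the plane, immersive on `dom ∩ halfPlane`, which maps `dom ∩ halfPlane`
homeomorphically onto the relatively open piece `S ∩ target` of `S`. If `dom` does not meet the
line `x² = 0` it parametrizes interior points only. -/
structure LocalParam (S : Set E3) where
  /-- the position vector as a function of the surface coordinates -/
  toFun : E2 → E3
  /-- the surface coordinates as a function of the position -/
  coords : E3 → E2
  dom : Set E2
  target : Set E3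
  isOpen_dom : IsOpen dom
  isOpen_target : IsOpen target
  smooth : ContDiffOn ℝ ∞ toFun dom
  regular : ∀ x ∈ dom ∩ halfPlane,
    LinearIndependent ℝ (fun i : Fin 2 => fderiv ℝ toFun x (EuclideanSpace.single i 1))
  image_eq : toFun '' (dom ∩ halfPlane) = S ∩ target
  coords_toFun : ∀ x ∈ dom ∩ halfPlane, coords (toFun x) = x
  continuousOn_coords : ContinuousOn coords (S ∩ target)

namespace LocalParam

/-- The covariant basis `gᵢ = ∂Σ/∂xⁱ`. -/
def tangent {S : Set E3} (P : LocalParam S) (i : Fin 2) (x : E2) : E3 :=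
  fderiv ℝ P.toFun x (EuclideanSpace.single i 1)

/-- The unit normal `g₁ × g₂ / |g₁ × g₂|`. -/
def unitNormal {S : Set E3} (P : LocalParam S) (x : E2) : E3 :=
  ‖cross (P.tangent 0 x) (P.tangent 1 x)‖⁻¹ • cross (P.tangent 0 x) (P.tangent 1 x)

/-- The covariant components `gᵢⱼ = (gᵢ, gⱼ)` of the metric tensor. -/
def metric {S : Set E3} (P : LocalParam S) (x : E2) : Matrix (Fin 2) (Fin 2) ℝ :=
  Matrix.of fun i j => inner ℝ (P.tangent i x) (P.tangent j x)

/-- The contravariant basis `gⁱ = gⁱʲ gⱼ`. -/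
def cotangent {S : Set E3} (P : LocalParam S) (i : Fin 2) (x : E2) : E3 :=
  ∑ j, (P.metric x)⁻¹ i j • P.tangent j x

/-- The covariant components `bᵢⱼ = (∂gᵢ/∂xʲ, n)` of the curvature tensor. -/
def curvatureCov {S : Set E3} (P : LocalParam S) (x : E2) : Matrix (Fin 2) (Fin 2) ℝ :=
  Matrix.of fun i j =>
    inner ℝ (fderiv ℝ (P.tangent i) x (EuclideanSpace.single j 1)) (P.unitNormal x)

/-- The mixed components `bⁱⱼ = gⁱᵏ bₖⱼ` of the curvature tensor. -/
def curvatureMixed {S : Set E3} (P : LocalParam S) (x : E2) : Matrix (Fin 2) (Fin 2) ℝ :=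
  (P.metric x)⁻¹ * P.curvatureCov x

/-- The curvature tensor `K = bᵢⱼ gⁱ ⊗ gʲ`. -/
def curvatureTensor {S : Set E3} (P : LocalParam S) (x : E2) : E3 →ₗ[ℝ] E3 :=
  ∑ i, ∑ j, P.curvatureCov x i j • dyad (P.cotangent i x) (P.cotangent j x)

/-- Gaussian curvature `K_G = det[bᵢⱼ] / det[gᵢⱼ]`. -/
def gaussCurvature {S : Set E3} (P : LocalParam S) (x : E2) : ℝ :=
  (P.curvatureCov x).det / (P.metric x).det

/-- The contravariant components `L̂ⁱʲ` of `L̂ = K_G K⁻¹`: the mixed components of `K⁻¹` form the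
inverse of the matrix `[bⁱⱼ]`, and the second index is raised with `gᵏʲ`. -/
def modifiedContra {S : Set E3} (P : LocalParam S) (x : E2) : Matrix (Fin 2) (Fin 2) ℝ :=
  P.gaussCurvature x • ((P.curvatureMixed x)⁻¹ * (P.metric x)⁻¹)

/-- The partial derivative `∂Φ/∂xʲ` of a field on the surface (one-sided at points of the
boundary line). -/
def fieldDeriv {S : Set E3} {V : Type*} [NormedAddCommGroup V] [NormedSpace ℝ V]
    (P : LocalParam S) (Φ : E3 → V) (j : Fin 2) (x : E2) : V :=
  fderivWithin ℝ (fun y => Φ (P.toFun y)) (P.dom ∩ halfPlane) x (EuclideanSpace.single j 1)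

/-- `(n × ∇̄) ∘ Φ = L̂ⁱʲ (n × gᵢ) ∘ ∂Φ/∂xʲ` for a bilinear operation `∘`, where
`∇̄ = L̂ⁱʲ gᵢ ∂/∂xʲ`. -/
def normalCrossGrad {S : Set E3} {V W : Type*} [NormedAddCommGroup V] [NormedSpace ℝ V]
    [AddCommGroup W] [Module ℝ W] (P : LocalParam S) (op : E3 →ₗ[ℝ] V →ₗ[ℝ] W)
    (Φ : E3 → V) (x : E2) : W :=
  ∑ i, ∑ j, P.modifiedContra x i j •
    op (cross (P.unitNormal x) (P.tangent i x)) (P.fieldDeriv Φ j x)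

end LocalParam

/-- A compact oriented smooth surface, possibly with (smooth) boundary, embedded in Euclidean
three-space. The orientation is given by the unit normal field `normal`, and there is a positively
oriented local parametrization around each point. -/
structure OrientedSurface where
  carrier : Set E3
  isCompact_carrier : IsCompact carrier
  normal : E3 → E3
  paramAt : E3 → LocalParam carrier
  mem_target : ∀ p ∈ carrier, p ∈ (paramAt p).target
  oriented : ∀ p ∈ carrier, ∀ x ∈ (paramAt p).dom ∩ halfPlane,
    (paramAt p).unitNormal x = normal ((paramAt p).toFun x)

namespace OrientedSurface

/-- The surface coordinates of the point `p` in the parametrization around `p`. -/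
def pt (S : OrientedSurface) (p : E3) : E2 := (S.paramAt p).coords p

/-- The boundary curve `∂Σ`: the points of the surface that lie on the boundary line of the
half-plane. -/
def boundary (S : OrientedSurface) : Set E3 := {p | p ∈ S.carrier ∧ S.pt p 1 = 0}

/-- The unit tangent of the boundary curve, `g₁ / |g₁|` for a positively oriented parametrization
by the half-plane `x² ≥ 0`: `(n × τ, g₂) > 0`, so `n × τ` points into the surface, as in the
classical Stokes formula. -/
def boundaryTangent (S : OrientedSurface) (p : E3) : E3 :=
  ‖(S.paramAt p).tangent 0 (S.pt p)‖⁻¹ • (S.paramAt p).tangent 0 (S.pt p)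

/-- The curvature tensor `K` at the point `p`. -/
def curvatureTensor (S : OrientedSurface) (p : E3) : E3 →ₗ[ℝ] E3 :=
  (S.paramAt p).curvatureTensor (S.pt p)

/-- `K` is nonsingular, `det[bⁱⱼ] ≠ 0`, at every point of the surface. -/
def CurvatureNonsingular (S : OrientedSurface) : Prop :=
  ∀ p ∈ S.carrier, ((S.paramAt p).curvatureMixed (S.pt p)).det ≠ 0

/-- A field on the surface is continuously differentiable (up to the boundary) in the surface
coordinates. -/
def ContDiffField (S : OrientedSurface) {V : Type*} [NormedAddCommGroup V] [NormedSpace ℝ V]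
    (Φ : E3 → V) : Prop :=
  ∀ p ∈ S.carrier,
    ContDiffOn ℝ 1 (fun x => Φ ((S.paramAt p).toFun x)) ((S.paramAt p).dom ∩ halfPlane)

/-- `(n × ∇̄) ∘ Φ` at the point `p`. -/
def normalCrossGrad (S : OrientedSurface) {V W : Type*} [NormedAddCommGroup V] [NormedSpace ℝ V]
    [AddCommGroup W] [Module ℝ W] (op : E3 →ₗ[ℝ] V →ₗ[ℝ] W) (Φ : E3 → V) (p : E3) : W :=
  (S.paramAt p).normalCrossGrad op Φ (S.pt p)

end OrientedSurface

end SurfaceCalculus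

end

noncomputable section

open Set Filter Topology Module
open scoped NNReal ENNReal

namespace SurfaceCalculus

/-! ### The area formula for Hausdorff measure -/

section AreaFormula

/-! The statement is Stokes' theorem for the one-form `-dn ∘ Φ`. Since `d(dn) = 0`, its exterior
derivative is `dn ∧ dΦ`, with coordinate density `∂₀n ∘ ∂₁Φ - ∂₁n ∘ ∂₀Φ` (`formDensity`; indices 0,
1 as in `Fin 2`). Two pointwise identities, both from the Weingarten equations, identify the two
integrands. Contracting a tangent vector with `K` gives minus the derivative of `n` along it
(`curvatureTensor_tangent`). And `K_G K⁻¹` has contravariant components `adj[b] / det[g]`, so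
contracting them with `n × gᵢ` gives the derivatives of `n` turned by a right angle, and `(n × ∇̄) ∘
Φ` is `formDensity` divided by the area density `|g₀ × g₁|` (`normalCrossGrad_eq`).

In one chart, for compactly supported `Φ`, this is the divergence theorem on the half-plane together
with the symmetry of the second derivatives of `n` (`integral_formDensity`). Surface area and arc
length are Hausdorff measures, so an area formula for injective immersions
(`euclideanHausdorffMeasure_image_eq_lintegral`) converts them to coordinate integrals.

The integrands at `p` are defined through the chart attached to `p`, which varies with `p` without
any regularity. They must therefore be shown independent of the chart: `IsTransition` carries the
first derivative of a change of charts, whose determinant is positive because the normals agree, and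
which at boundary points maps `e 0` to a positive multiple of itself. A smooth partition of unity
then reduces the general field to fields supported in one chart. -/

theorem lipschitzOnWith_comp_invFunOn {α X Y : Type*} [Nonempty α] [EMetricSpace X]
    [EMetricSpace Y] {g : α → Y} {h : α → X} {A : Set α} {t : ℝ≥0}
    (H : ∀ y ∈ A, ∀ z ∈ A, edist (g y) (g z) ≤ t * edist (h y) (h z)) :
    LipschitzOnWith t (g ∘ Function.invFunOn h A) (h '' A) ∧
      (g ∘ Function.invFunOn h A) '' (h '' A) = g '' A := by
  have key : ∀ y ∈ A, Function.invFunOn h A (h y) ∈ A ∧ h (Function.invFunOn h A (h y)) = h y :=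
    fun y hy => ⟨Function.invFunOn_mem ⟨y, hy, rfl⟩, Function.invFunOn_eq ⟨y, hy, rfl⟩⟩
  refine ⟨?_, ?_⟩
  · rintro _ ⟨y, hy, rfl⟩ _ ⟨z, hz, rfl⟩
    simpa [(key y hy).2, (key z hz).2] using H _ (key y hy).1 _ (key z hz).1
  · rw [image_image]
    refine image_congr fun y hy => ?_
    have := H _ (key y hy).1 y hy
    rw [(key y hy).2, edist_self, mul_zero, nonpos_iff_eq_zero, edist_eq_zero] at this
    exact this

/-- Used with an immersion and its derivative in the roles of `g` and `h`, in both orders: only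
distances are compared, so no inverse has to be differentiated. -/
theorem euclideanHausdorffMeasure_image_le_of_edist_le {α X Y : Type*} [Nonempty α]
    [EMetricSpace X] [EMetricSpace Y] [MeasurableSpace X] [BorelSpace X] [MeasurableSpace Y]
    [BorelSpace Y] {g : α → Y} {h : α → X} {A : Set α} {t : ℝ≥0} (n : ℕ)
    (H : ∀ y ∈ A, ∀ z ∈ A, edist (g y) (g z) ≤ t * edist (h y) (h z)) :
    μHE[n] (g '' A) ≤ (t : ℝ≥0∞) ^ n * μHE[n] (h '' A) := by
  obtain ⟨h1, h2⟩ := lipschitzOnWith_comp_invFunOn H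
  have := h1.hausdorffMeasure_image_le (d := n) (by positivity)
  rw [h2] at this
  simp only [Measure.euclideanHausdorffMeasure_def, Measure.smul_apply, Measure.nnreal_smul_coe_apply]
  rw [mul_left_comm]
  gcongr
  simpa using this

variable {E F : Type*} [NormedAddCommGroup E] [InnerProductSpace ℝ E] [FiniteDimensional ℝ E]
  [MeasurableSpace E] [BorelSpace E]
  [NormedAddCommGroup F] [InnerProductSpace ℝ F] [MeasurableSpace F] [BorelSpace F]

omit [MeasurableSpace E] [BorelSpace E] [MeasurableSpace F] [BorelSpace F] in
-- Strict differentiability bounds the error `f y - f z - L (y - z)` by a small multiple of `‖y -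
-- z‖`, and an injective `L` bounds `‖y - z‖` by a multiple of `‖L y - L z‖`.
theorem exists_nhds_edist_comparison {f : E → F} {L : E →L[ℝ] F} {x : E}
    (hf : HasStrictFDerivAt f L x) (hL : Function.Injective L) {t : ℝ≥0} (ht : 1 < t) :
    ∃ U ∈ 𝓝 x, ∀ y ∈ U, ∀ z ∈ U, edist (f y) (f z) ≤ t * edist (L y) (L z) ∧
      edist (L y) (L z) ≤ t * edist (f y) (f z) := by
  obtain ⟨K, hK0, hK⟩ := (LinearMap.injective_iff_antilipschitz (L : E →ₗ[ℝ] F)).1 hL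
  have ht' : (1 : ℝ) < t := by exact_mod_cast ht
  have ht0 : (0 : ℝ) < t := by linarith
  have hK0' : (0 : ℝ) < K := by exact_mod_cast hK0
  -- Chosen so that the error is at most `(1 - 1/t) ‖L y - L z‖`; this gives the factor `1/t` from
  -- below and, as `1 - 1/t ≤ t - 1`, the factor `t` from above.
  set c : ℝ := (1 - 1 / t) / K with hc
  have h1t : 0 < 1 - 1 / (t : ℝ) := by
    have : 1 / (t : ℝ) < 1 := by rw [div_lt_one ht0]; exact ht'
    linarith
  have hc0 : 0 < c := by positivity
  have := hf.isLittleO.def hc0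
  rw [nhds_prod_eq, Filter.eventually_iff] at this
  obtain ⟨U, hU, hUU⟩ := Filter.mem_prod_same_iff.1 this
  refine ⟨U, hU, fun y hy z hz => ?_⟩
  have h1 : ‖f y - f z - L (y - z)‖ ≤ c * ‖y - z‖ := hUU (Set.mk_mem_prod hy hz)
  have h2 : ‖y - z‖ ≤ K * ‖L y - L z‖ := by
    simpa [dist_eq_norm] using hK.le_mul_dist y z
  rw [map_sub] at h1
  have h3 : ‖f y - f z - (L y - L z)‖ ≤ (1 - 1 / t) * ‖L y - L z‖ := by
    calc _ ≤ c * ‖y - z‖ := h1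
      _ ≤ c * (K * ‖L y - L z‖) := by gcongr
      _ = _ := by rw [hc]; field_simp
  have h4 := norm_sub_norm_le (f y - f z) (L y - L z)
  have h5 := norm_sub_norm_le (L y - L z) (f y - f z)
  rw [norm_sub_rev (L y - L z)] at h5
  have h6 : 1 - 1 / (t : ℝ) ≤ t - 1 := by
    have h7 : 1 - 1 / (t : ℝ) = (t - 1) / t := by field_simp
    rw [h7, div_le_iff₀ ht0]
    nlinarith
  have hn := norm_nonneg (L y - L z)
  simp only [edist_nndist, ← ENNReal.coe_mul, ENNReal.coe_le_coe, ← NNReal.coe_le_coe,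
    NNReal.coe_mul, coe_nndist, dist_eq_norm]
  constructor
  · nlinarith
  · have : 1 / (t : ℝ) * ‖L y - L z‖ ≤ ‖f y - f z‖ := by linarith
    rw [one_div, inv_mul_le_iff₀ ht0] at this
    exact this

/-- For the linear map `f' x` the formula is exact. Replacing `f` by `f' x` costs `t` to the power
of the dimension, and freezing `J` at `x` costs one more factor `t`. -/
theorem exists_nhdsWithin_measure_comparison {f : E → F} {f' : E → E →L[ℝ] F} {J : E → ℝ}
    {D : Set E} (hf : ∀ x ∈ D, HasStrictFDerivAt f (f' x) x)
    (hinj : ∀ x ∈ D, Function.Injective (f' x))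
    (hJ : ∀ x ∈ D, (f' x : E →ₗ[ℝ] F).normDet = J x) (hJc : ContinuousOn J D)
    {x : E} (hx : x ∈ D) {t : ℝ≥0} (ht : 1 < t) :
    ∃ U ∈ 𝓝[D] x, ∀ A ⊆ U ∩ D, MeasurableSet A →
      μHE[finrank ℝ E] (f '' A) ≤ (t : ℝ≥0∞) ^ (finrank ℝ E + 1) * ∫⁻ y in A, ENNReal.ofReal (J y) ∧
      ∫⁻ y in A, ENNReal.ofReal (J y) ≤ (t : ℝ≥0∞) ^ (finrank ℝ E + 1) * μHE[finrank ℝ E] (f '' A) := by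
  obtain ⟨U, hU, hUc⟩ := exists_nhds_edist_comparison (hf x hx) (hinj x hx) ht
  have ht' : (1 : ℝ) < t := by exact_mod_cast ht
  have ht0 : (0 : ℝ) < t := by linarith
  have hJx : 0 < J x := by
    rw [← hJ x hx]
    refine lt_of_le_of_ne (LinearMap.normDet_nonneg _) (Ne.symm ?_)
    exact ((LinearMap.normDet_ne_zero_tfae (f' x : E →ₗ[ℝ] F)).out 0 4).2 (hinj x hx)
  have hcont := hJc x hx
  have e1 : ∀ᶠ y in 𝓝[D] x, J y < t * J x := hcont.eventually_lt_const (by nlinarith)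
  have e2 : ∀ᶠ y in 𝓝[D] x, J x / t < J y := hcont.eventually_const_lt (by
    rw [div_lt_iff₀ ht0]; nlinarith)
  refine ⟨U ∩ {y | J y < t * J x ∧ J x / t < J y},
    inter_mem (mem_nhdsWithin_of_mem_nhds hU) (e1.and e2), fun A hA hAm => ?_⟩
  have hLA : μHE[finrank ℝ E] (f' x '' A) = ENNReal.ofReal (J x) * volume A := by
    rw [← hJ x hx]
    exact LinearMap.euclideanHausdorffMeasure_image_eq_normDet_mul_volume _ _
  have hup : μHE[finrank ℝ E] (f '' A) ≤ (t : ℝ≥0∞) ^ (finrank ℝ E) * μHE[finrank ℝ E] (f' x '' A) :=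
    euclideanHausdorffMeasure_image_le_of_edist_le _
      fun y hy z hz => (hUc y (hA hy).1.1 z (hA hz).1.1).1
  have hlo : μHE[finrank ℝ E] (f' x '' A) ≤ (t : ℝ≥0∞) ^ (finrank ℝ E) * μHE[finrank ℝ E] (f '' A) :=
    euclideanHausdorffMeasure_image_le_of_edist_le _
      fun y hy z hz => (hUc y (hA hy).1.1 z (hA hz).1.1).2
  have hcoe : ∀ r : ℝ, ENNReal.ofReal (t * r) = (t : ℝ≥0∞) * ENNReal.ofReal r := fun r => by
    rw [ENNReal.ofReal_mul ht0.le, ENNReal.ofReal_coe_nnreal]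
  have hint1 : ENNReal.ofReal (J x) * volume A ≤ t * ∫⁻ y in A, ENNReal.ofReal (J y) := by
    rw [← setLIntegral_const, ← lintegral_const_mul' _ _ ENNReal.coe_ne_top]
    refine setLIntegral_mono' hAm fun y hy => ?_
    rw [← hcoe]
    refine ENNReal.ofReal_le_ofReal ?_
    have := (hA hy).1.2.2.le
    rw [div_le_iff₀ ht0] at this
    linarith
  have hint2 : ∫⁻ y in A, ENNReal.ofReal (J y) ≤ t * (ENNReal.ofReal (J x) * volume A) := by
    rw [← setLIntegral_const, ← lintegral_const_mul' _ _ ENNReal.coe_ne_top]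
    refine setLIntegral_mono' hAm fun y hy => ?_
    rw [← hcoe]
    exact ENNReal.ofReal_le_ofReal (hA hy).1.2.1.le
  rw [hLA] at hup hlo
  constructor
  · calc _ ≤ _ := hup
      _ ≤ (t : ℝ≥0∞) ^ (finrank ℝ E) * (t * ∫⁻ y in A, ENNReal.ofReal (J y)) := by gcongr
      _ = _ := by rw [pow_succ, mul_assoc]
  · calc _ ≤ _ := hint2
      _ ≤ t * ((t : ℝ≥0∞) ^ (finrank ℝ E) * μHE[finrank ℝ E] (f '' A)) := by gcongr
      _ = _ := by rw [pow_succ', mul_assoc]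

theorem le_of_forall_one_lt_pow_mul {a b : ℝ≥0∞} (n : ℕ)
    (h : ∀ t : ℝ≥0, 1 < t → a ≤ (t : ℝ≥0∞) ^ n * b) : a ≤ b := by
  have ht : Tendsto (fun t : ℝ≥0 => (t : ℝ≥0∞) ^ n * b) (𝓝[>] 1) (𝓝 (((1 : ℝ≥0) : ℝ≥0∞) ^ n * b)) := by
    refine ENNReal.Tendsto.mul_const ?_ (Or.inl (by simp))
    exact ((ENNReal.continuous_pow n).comp ENNReal.continuous_coe).continuousWithinAt
  rw [ENNReal.coe_one, one_pow, one_mul] at ht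
  exact ge_of_tendsto ht (eventually_mem_nhdsWithin.mono fun t ht => h t ht)

/-- The area formula for injective immersions. -/
theorem euclideanHausdorffMeasure_image_eq_lintegral {f : E → F} {f' : E → E →L[ℝ] F} {J : E → ℝ}
    {D : Set E} (hf : ∀ x ∈ D, HasStrictFDerivAt f (f' x) x)
    (hinj : ∀ x ∈ D, Function.Injective (f' x)) (hfD : InjOn f D)
    (hJ : ∀ x ∈ D, (f' x : E →ₗ[ℝ] F).normDet = J x) (hJc : ContinuousOn J D)
    {A : Set E} (hAD : A ⊆ D) (hA : MeasurableSet A) :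
    μHE[finrank ℝ E] (f '' A) = ∫⁻ y in A, ENNReal.ofReal (J y) := by
  have key : ∀ t : ℝ≥0, 1 < t →
      μHE[finrank ℝ E] (f '' A) ≤ (t : ℝ≥0∞) ^ (finrank ℝ E + 1) * ∫⁻ y in A, ENNReal.ofReal (J y) ∧
      ∫⁻ y in A, ENNReal.ofReal (J y) ≤ (t : ℝ≥0∞) ^ (finrank ℝ E + 1) * μHE[finrank ℝ E] (f '' A) := by
    intro t ht
    choose! U hU hUA using fun x (hx : x ∈ D) =>
      exists_nhdsWithin_measure_comparison hf hinj hJ hJc hx ht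
    choose! O hO hOU using fun x (hx : x ∈ D) => mem_nhdsWithin_iff_exists_mem_nhds_inter.1 (hU x hx)
    -- Lindelöf: countably many good neighbourhoods cover `D`; made disjoint, they cut `A` into
    -- pieces on which the local comparison holds.
    obtain ⟨s, hsD, hsc, hDs⟩ := TopologicalSpace.countable_cover_nhdsWithin
      (f := fun x => interior (O x)) (s := D)
      (fun x hx => mem_nhdsWithin_of_mem_nhds (interior_mem_nhds.2 (hO x hx)))
    rcases s.eq_empty_or_nonempty with rfl | hne
    · have : A = ∅ := by
        refine eq_empty_of_subset_empty ((hAD.trans hDs).trans ?_)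
        simp
      simp [this]
    obtain ⟨u, rfl⟩ := hsc.exists_eq_range hne
    set B : ℕ → Set E := fun n => A ∩ disjointed (fun n => interior (O (u n))) n with hB
    have hBm : ∀ n, MeasurableSet (B n) := fun n =>
      hA.inter (MeasurableSet.disjointed (fun n => isOpen_interior.measurableSet) n)
    have hBA : ∀ n, B n ⊆ A := fun n => inter_subset_left
    have hBd : Pairwise (Function.onFun Disjoint B) := fun i j hij =>
      ((disjoint_disjointed (fun n => interior (O (u n)))) hij).mono inter_subset_right inter_subset_right
    have hBU : ⋃ n, B n = A := by
      rw [hB, ← inter_iUnion, iUnion_disjointed, inter_eq_left]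
      refine (hAD.trans hDs).trans ?_
      simp
    have hBO : ∀ n, B n ⊆ U (u n) ∩ D := fun n y hy =>
      ⟨hOU _ (hsD ⟨n, rfl⟩) ⟨interior_subset (disjointed_subset (fun n => interior (O (u n))) _ hy.2), hAD hy.1⟩, hAD hy.1⟩
    have hcont : ContinuousOn f D := fun x hx =>
      (hf x hx).hasFDerivAt.continuousAt.continuousWithinAt
    -- The images of the pieces are disjoint by injectivity and measurable by the Lusin–Souslin
    -- theorem.
    have e1 : μHE[finrank ℝ E] (f '' A) = ∑' n, μHE[finrank ℝ E] (f '' B n) := by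
      rw [← hBU, image_iUnion, measure_iUnion]
      · intro i j hij
        refine disjoint_iff_inter_eq_empty.2 ?_
        rw [← hfD.image_inter ((hBA i).trans hAD) ((hBA j).trans hAD),
          disjoint_iff_inter_eq_empty.1 (hBd hij), image_empty]
      · exact fun n => (hBm n).image_of_continuousOn_injOn (hcont.mono ((hBA n).trans hAD))
          (hfD.mono ((hBA n).trans hAD))
    have e2 : ∫⁻ y in A, ENNReal.ofReal (J y) = ∑' n, ∫⁻ y in B n, ENNReal.ofReal (J y) := by
      conv_lhs => rw [← hBU]
      exact lintegral_iUnion hBm hBd _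
    rw [e1, e2, ← ENNReal.tsum_mul_left, ← ENNReal.tsum_mul_left]
    exact ⟨ENNReal.tsum_le_tsum fun n => (hUA _ (hsD ⟨n, rfl⟩) _ (hBO n) (hBm n)).1,
      ENNReal.tsum_le_tsum fun n => (hUA _ (hsD ⟨n, rfl⟩) _ (hBO n) (hBm n)).2⟩
  exact le_antisymm (le_of_forall_one_lt_pow_mul _ fun t ht => (key t ht).1)
    (le_of_forall_one_lt_pow_mul _ fun t ht => (key t ht).2)

theorem restrict_image_eq_map_withDensity {f : E → F} {f' : E → E →L[ℝ] F} {J : E → ℝ}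
    {D : Set E} (hD : MeasurableSet D) (hf : ∀ x ∈ D, HasStrictFDerivAt f (f' x) x)
    (hinj : ∀ x ∈ D, Function.Injective (f' x)) (hfD : InjOn f D)
    (hJ : ∀ x ∈ D, (f' x : E →ₗ[ℝ] F).normDet = J x) (hJc : ContinuousOn J D) :
    Measure.map (D.domRestrict f)
        (Measure.comap Subtype.val (volume.withDensity fun x => ENNReal.ofReal (J x))) =
      μHE[finrank ℝ E].restrict (f '' D) := by
  have hcont : ContinuousOn f D := fun x hx =>
    (hf x hx).hasFDerivAt.continuousAt.continuousWithinAt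
  have hemb : MeasurableEmbedding (D.domRestrict f) := hcont.measurableEmbedding hD hfD
  ext s hs
  rw [hemb.map_apply, Measure.restrict_apply hs, Measure.comap_apply _ Subtype.val_injective
    (fun t ht => (MeasurableEmbedding.subtype_coe hD).measurableSet_image' ht) _
    (hemb.measurable hs)]
  have h1 : Subtype.val '' (D.domRestrict f ⁻¹' s) = D ∩ f ⁻¹' s := by
    ext y; simp [Set.domRestrict, and_comm]
  have h2 : MeasurableSet (D ∩ f ⁻¹' s) := by
    rw [← h1]; exact (MeasurableEmbedding.subtype_coe hD).measurableSet_image' (hemb.measurable hs)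
  rw [h1, withDensity_apply _ h2, ← euclideanHausdorffMeasure_image_eq_lintegral hf hinj hfD hJ hJc
    inter_subset_left h2, image_inter_preimage, inter_comm]

theorem integrableOn_image_iff {f : E → F} {f' : E → E →L[ℝ] F} {J : E → ℝ}
    {D : Set E} (hD : MeasurableSet D) (hf : ∀ x ∈ D, HasStrictFDerivAt f (f' x) x)
    (hinj : ∀ x ∈ D, Function.Injective (f' x)) (hfD : InjOn f D)
    (hJ : ∀ x ∈ D, (f' x : E →ₗ[ℝ] F).normDet = J x) (hJc : ContinuousOn J D)
    {G : Type*} [NormedAddCommGroup G] [NormedSpace ℝ G] (g : F → G) :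
    IntegrableOn g (f '' D) μHE[finrank ℝ E] ↔ IntegrableOn (fun x => J x • g (f x)) D := by
  have hcont : ContinuousOn f D := fun x hx =>
    (hf x hx).hasFDerivAt.continuousAt.continuousWithinAt
  rw [IntegrableOn, ← restrict_image_eq_map_withDensity hD hf hinj hfD hJ hJc,
    (hcont.measurableEmbedding hD hfD).integrable_map_iff]
  simp only [Set.domRestrict_eq, ← Function.comp_assoc, ENNReal.ofReal]
  rw [← (MeasurableEmbedding.subtype_coe hD).integrable_map_iff, map_comap_subtype_coe hD,
    restrict_withDensity hD, integrable_withDensity_iff_integrable_coe_smul₀]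
  · refine integrableOn_congr_fun (fun x hx => ?_) hD
    simp only [Function.comp_apply]
    rw [Real.coe_toNNReal _ (by rw [← hJ x hx]; exact LinearMap.normDet_nonneg _)]
  · exact (hJc.aemeasurable hD).real_toNNReal

theorem setIntegral_image_eq {f : E → F} {f' : E → E →L[ℝ] F} {J : E → ℝ}
    {D : Set E} (hD : MeasurableSet D) (hf : ∀ x ∈ D, HasStrictFDerivAt f (f' x) x)
    (hinj : ∀ x ∈ D, Function.Injective (f' x)) (hfD : InjOn f D)
    (hJ : ∀ x ∈ D, (f' x : E →ₗ[ℝ] F).normDet = J x) (hJc : ContinuousOn J D)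
    {G : Type*} [NormedAddCommGroup G] [NormedSpace ℝ G] (g : F → G) :
    ∫ y in f '' D, g y ∂μHE[finrank ℝ E] = ∫ x in D, J x • g (f x) := by
  have hcont : ContinuousOn f D := fun x hx =>
    (hf x hx).hasFDerivAt.continuousAt.continuousWithinAt
  rw [← restrict_image_eq_map_withDensity hD hf hinj hfD hJ hJc,
    (hcont.measurableEmbedding hD hfD).integral_map]
  simp only [Set.domRestrict_apply, ← Function.comp_apply (f := g), ENNReal.ofReal]
  rw [← (MeasurableEmbedding.subtype_coe hD).integral_map, map_comap_subtype_coe hD,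
    setIntegral_withDensity_eq_setIntegral_smul₀ (hJc.aemeasurable hD).real_toNNReal _ hD]
  refine setIntegral_congr_fun hD fun x hx => ?_
  simp only [Function.comp_apply, NNReal.smul_def]
  rw [Real.coe_toNNReal _ (by rw [← hJ x hx]; exact LinearMap.normDet_nonneg _)]

end AreaFormula

/-! ### Cross product identities -/

section Cross

theorem inner_eq_sum (a b : E3) : inner ℝ a b = a 0 * b 0 + a 1 * b 1 + a 2 * b 2 := by
  simp [PiLp.inner_apply, Fin.sum_univ_three, mul_comm]

@[simp] theorem cross_apply_zero (a b : E3) : cross a b 0 = a 1 * b 2 - a 2 * b 1 := by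
  simp [cross, cross_apply]

@[simp] theorem cross_apply_one (a b : E3) : cross a b 1 = a 2 * b 0 - a 0 * b 2 := by
  simp [cross, cross_apply]

@[simp] theorem cross_apply_two (a b : E3) : cross a b 2 = a 0 * b 1 - a 1 * b 0 := by
  simp [cross, cross_apply]

theorem ext_three {a b : E3} (h0 : a 0 = b 0) (h1 : a 1 = b 1) (h2 : a 2 = b 2) : a = b := by
  ext i; fin_cases i <;> assumption

theorem inner_cross_left (a b : E3) : inner ℝ a (cross a b) = 0 := by
  simp [inner_eq_sum]; ring

theorem inner_cross_right (a b : E3) : inner ℝ b (cross a b) = 0 := by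
  simp [inner_eq_sum]; ring

/-- Lagrange's identity. -/
theorem norm_cross_sq (a b : E3) :
    ‖cross a b‖ ^ 2 = inner ℝ a a * inner ℝ b b - inner ℝ a b * inner ℝ a b := by
  rw [← real_inner_self_eq_norm_sq]
  simp only [inner_eq_sum, cross_apply_zero, cross_apply_one, cross_apply_two]; ring

theorem cross_cross_left (a b : E3) :
    cross (cross a b) a = inner ℝ a a • b - inner ℝ a b • a := by
  simp only [inner_eq_sum]
  apply ext_three <;> simp <;> ring

theorem cross_cross_right (a b : E3) :
    cross (cross a b) b = inner ℝ a b • b - inner ℝ b b • a := by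
  simp only [inner_eq_sum]
  apply ext_three <;> simp <;> ring

theorem cross_smul_left (r : ℝ) (a b : E3) : cross (r • a) b = r • cross a b := by
  apply ext_three <;> simp <;> ring

theorem cross_combination (a b : E3) (p q r s : ℝ) :
    cross (p • a + q • b) (r • a + s • b) = (p * s - q * r) • cross a b := by
  apply ext_three <;> simp <;> ring

/-- Decomposition of a vector in the frame `a, b, a × b`. -/
theorem norm_cross_sq_smul (a b m : E3) (h : inner ℝ m (cross a b) = 0) :
    ‖cross a b‖ ^ 2 • m =
      (inner ℝ m a * inner ℝ b b - inner ℝ m b * inner ℝ a b) • a +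
        (inner ℝ m b * inner ℝ a a - inner ℝ m a * inner ℝ a b) • b := by
  have key : ‖cross a b‖ ^ 2 • m = inner ℝ m (cross a b) • cross a b +
      (inner ℝ m a * inner ℝ b b - inner ℝ m b * inner ℝ a b) • a +
        (inner ℝ m b * inner ℝ a a - inner ℝ m a * inner ℝ a b) • b := by
    simp only [norm_cross_sq, inner_eq_sum]
    apply ext_three <;> simp <;> ring
  rw [key, h, zero_smul, zero_add]

theorem cross_ne_zero {a b : E3} (h : LinearIndependent ℝ ![a, b]) : cross a b ≠ 0 := by
  intro h0
  have h1 := cross_cross_right a b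
  rw [h0] at h1
  have h2 : cross 0 b = 0 := by apply ext_three <;> simp
  rw [h2] at h1
  have h3 := LinearIndependent.pair_iff.1 h (-inner ℝ b b) (inner ℝ a b) (by
    rw [neg_smul, neg_add_eq_sub]; exact h1.symm)
  have hb : b = 0 := by simpa using h3.1
  simpa [hb] using LinearIndependent.pair_iff.1 h 0 1

theorem contDiffOn_cross {E : Type*} [NormedAddCommGroup E] [NormedSpace ℝ E] {f g : E → E3}
    {s : Set E} {n : WithTop ℕ∞} (hf : ContDiffOn ℝ n f s) (hg : ContDiffOn ℝ n g s) :
    ContDiffOn ℝ n (fun x => cross (f x) (g x)) s := by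
  rw [contDiffOn_euclidean] at *
  intro i
  fin_cases i
  · simpa using ((hf 1).mul (hg 2)).sub ((hf 2).mul (hg 1))
  · simpa using ((hf 2).mul (hg 0)).sub ((hf 0).mul (hg 2))
  · simpa using ((hf 0).mul (hg 1)).sub ((hf 1).mul (hg 0))

end Cross

/-- The coordinate directions of the parameter plane. -/
abbrev e (i : Fin 2) : E2 := EuclideanSpace.single i 1

/-! ### Weingarten equations and the two integrands in a chart -/

namespace LocalParam

variable {S : Set E3} (P : LocalParam S)

/-- The parameters of a chart. -/
def paramDomain : Set E2 := P.dom ∩ halfPlane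

/-- The area density `|g₁ × g₂|`. -/
def areaDensity (x : E2) : ℝ := ‖cross (P.tangent 0 x) (P.tangent 1 x)‖

/-- The partial derivatives of the unit normal. -/
def normalDeriv (i : Fin 2) (x : E2) : E3 := fderiv ℝ P.unitNormal x (e i)

/-- The open set on which the map of a chart is an immersion. -/
def immersionDomain : Set E2 := P.dom ∩ {x | cross (P.tangent 0 x) (P.tangent 1 x) ≠ 0}

theorem cross_tangent_ne_zero {x : E2} (hx : x ∈ P.paramDomain) :
    cross (P.tangent 0 x) (P.tangent 1 x) ≠ 0 := by
  refine cross_ne_zero ?_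
  convert P.regular x hx using 1
  ext i : 1
  fin_cases i <;> rfl

theorem contDiffOn_tangent (i : Fin 2) : ContDiffOn ℝ ∞ (P.tangent i) P.dom :=
  (P.smooth.fderiv_of_isOpen P.isOpen_dom (by simp)).clm_apply contDiffOn_const

theorem contDiffOn_cross_tangent :
    ContDiffOn ℝ ∞ (fun x => cross (P.tangent 0 x) (P.tangent 1 x)) P.dom :=
  contDiffOn_cross (P.contDiffOn_tangent 0) (P.contDiffOn_tangent 1)

theorem isOpen_immersionDomain : IsOpen P.immersionDomain :=
  P.contDiffOn_cross_tangent.continuousOn.isOpen_inter_preimage P.isOpen_dom isOpen_compl_singleton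

/-- The normal extends smoothly across the boundary line, so its derivatives are ordinary ones even
there; only `Φ` needs one-sided derivatives. -/
theorem paramDomain_subset : P.paramDomain ⊆ P.immersionDomain :=
  fun _ hx => ⟨hx.1, P.cross_tangent_ne_zero hx⟩

theorem contDiffOn_areaDensity : ContDiffOn ℝ ∞ P.areaDensity P.immersionDomain :=
  (P.contDiffOn_cross_tangent.mono inter_subset_left).norm ℝ fun _ hx => hx.2

theorem areaDensity_pos {x : E2} (hx : x ∈ P.immersionDomain) : 0 < P.areaDensity x :=
  norm_pos_iff.2 hx.2

theorem contDiffOn_unitNormal : ContDiffOn ℝ ∞ P.unitNormal P.immersionDomain :=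
  (P.contDiffOn_areaDensity.inv fun _ hx => (P.areaDensity_pos hx).ne').smul
    (P.contDiffOn_cross_tangent.mono inter_subset_left)

theorem contDiffOn_normalDeriv (i : Fin 2) : ContDiffOn ℝ ∞ (P.normalDeriv i) P.immersionDomain :=
  (P.contDiffOn_unitNormal.fderiv_of_isOpen P.isOpen_immersionDomain (by simp)).clm_apply
    contDiffOn_const

theorem differentiableAt_toFun {x : E2} (hx : x ∈ P.dom) : DifferentiableAt ℝ P.toFun x :=
  (P.smooth.contDiffAt (P.isOpen_dom.mem_nhds hx)).differentiableAt (by simp)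

theorem differentiableAt_tangent (i : Fin 2) {x : E2} (hx : x ∈ P.dom) :
    DifferentiableAt ℝ (P.tangent i) x :=
  ((P.contDiffOn_tangent i).contDiffAt (P.isOpen_dom.mem_nhds hx)).differentiableAt (by simp)

theorem differentiableAt_unitNormal {x : E2} (hx : x ∈ P.immersionDomain) :
    DifferentiableAt ℝ P.unitNormal x :=
  (P.contDiffOn_unitNormal.contDiffAt (P.isOpen_immersionDomain.mem_nhds hx)).differentiableAt
    (by simp)

theorem inner_tangent_unitNormal (i : Fin 2) (x : E2) :
    inner ℝ (P.tangent i x) (P.unitNormal x) = 0 := by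
  rw [unitNormal, inner_smul_right]
  fin_cases i
  · simp [inner_cross_left]
  · simp [inner_cross_right]

theorem norm_unitNormal {x : E2} (hx : x ∈ P.immersionDomain) : ‖P.unitNormal x‖ = 1 := by
  rw [unitNormal, norm_smul, norm_inv, norm_norm]
  exact inv_mul_cancel₀ (P.areaDensity_pos hx).ne'

/-- Used twice: for the position vector it makes `b` symmetric, and for the unit normal it says that
`dn` is closed. -/
theorem fderiv_fderiv_symm {F : Type*} [NormedAddCommGroup F] [NormedSpace ℝ F] {f : E2 → F}
    {s : Set E2} (hs : IsOpen s) (hf : ContDiffOn ℝ ∞ f s) {x : E2} (hx : x ∈ s) (u v : E2) :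
    fderiv ℝ (fun y => fderiv ℝ f y u) x v = fderiv ℝ (fun y => fderiv ℝ f y v) x u := by
  have hd : DifferentiableAt ℝ (fderiv ℝ f) x :=
    ((hf.fderiv_of_isOpen hs (m := ∞) (by simp)).contDiffAt (hs.mem_nhds hx)).differentiableAt
      (by simp)
  rw [fderiv_clm_apply hd (differentiableAt_const _), fderiv_clm_apply hd (differentiableAt_const _)]
  simpa using ((hf.contDiffAt (hs.mem_nhds hx)).isSymmSndFDerivAt (by
    rw [minSmoothness_of_isRCLikeNormedField]; exact WithTop.coe_le_coe.2 le_top)).eq v u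

/-- The Weingarten equations, in covariant components. -/
theorem curvatureCov_eq {x : E2} (hx : x ∈ P.immersionDomain) (i j : Fin 2) :
    P.curvatureCov x i j = -inner ℝ (P.normalDeriv j x) (P.tangent i x) := by
  have h1 : fderiv ℝ (fun y => inner ℝ (P.tangent i y) (P.unitNormal y)) x (e j) = 0 := by
    have : (fun y => inner ℝ (P.tangent i y) (P.unitNormal y)) = fun _ => (0 : ℝ) := by
      ext y; exact P.inner_tangent_unitNormal i y
    rw [this]; simp
  rw [fderiv_inner_apply ℝ (P.differentiableAt_tangent i hx.1) (P.differentiableAt_unitNormal hx)] at h1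
  rw [curvatureCov, Matrix.of_apply, normalDeriv, real_inner_comm (P.tangent i x)]
  linarith

theorem curvatureCov_symm {x : E2} (hx : x ∈ P.dom) (i j : Fin 2) :
    P.curvatureCov x i j = P.curvatureCov x j i := by
  simp only [curvatureCov, Matrix.of_apply]
  congr 1
  exact fderiv_fderiv_symm P.isOpen_dom P.smooth hx _ _

theorem inner_normalDeriv_unitNormal {x : E2} (hx : x ∈ P.immersionDomain) (i : Fin 2) :
    inner ℝ (P.normalDeriv i x) (P.unitNormal x) = 0 := by
  have h1 : fderiv ℝ (fun y => inner ℝ (P.unitNormal y) (P.unitNormal y)) x (e i) = 0 := by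
    have : (fun y => inner ℝ (P.unitNormal y) (P.unitNormal y)) =ᶠ[𝓝 x] fun _ => (1 : ℝ) := by
      filter_upwards [P.isOpen_immersionDomain.mem_nhds hx] with y hy
      rw [real_inner_self_eq_norm_sq, P.norm_unitNormal hy, one_pow]
    rw [this.fderiv_eq]; simp
  have hd := P.differentiableAt_unitNormal hx
  rw [fderiv_inner_apply ℝ hd hd, real_inner_comm] at h1
  rw [normalDeriv]
  linarith

/-- The derivative of `n` is tangent because `|n| = 1`, so its inner products with `g₀` and `g₁`
determine it. Multiplying by `det g = |g₀ × g₁|²` avoids the inverse metric. -/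
theorem areaDensity_sq_smul_normalDeriv {x : E2} (hx : x ∈ P.immersionDomain) (i : Fin 2) :
    P.areaDensity x ^ 2 • P.normalDeriv i x =
      (P.curvatureCov x 1 i * P.metric x 0 1 - P.curvatureCov x 0 i * P.metric x 1 1) •
          P.tangent 0 x +
        (P.curvatureCov x 0 i * P.metric x 0 1 - P.curvatureCov x 1 i * P.metric x 0 0) •
          P.tangent 1 x := by
  have h := P.inner_normalDeriv_unitNormal hx i
  rw [unitNormal, inner_smul_right, mul_eq_zero] at h
  rw [areaDensity, norm_cross_sq_smul _ _ _ (h.resolve_left (inv_ne_zero (P.areaDensity_pos hx).ne'))]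
  simp only [P.curvatureCov_eq hx, metric, Matrix.of_apply]
  congr 2 <;> ring

theorem det_metric (x : E2) : (P.metric x).det = P.areaDensity x ^ 2 := by
  rw [areaDensity, norm_cross_sq, Matrix.det_fin_two]
  simp only [metric, Matrix.of_apply]
  rw [real_inner_comm (P.tangent 0 x) (P.tangent 1 x)]

theorem metric_symm (x : E2) : P.metric x 1 0 = P.metric x 0 1 := by
  simp only [metric, Matrix.of_apply, real_inner_comm]

theorem isUnit_det_metric {x : E2} (hx : x ∈ P.immersionDomain) : IsUnit (P.metric x).det := by
  rw [det_metric]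
  exact (pow_pos (P.areaDensity_pos hx) 2).ne'.isUnit

/-- `(g⁻¹ b)⁻¹ g⁻¹ = b⁻¹`, and the factor `det b / det g` turns `b⁻¹` into `adj b / det g`. This is
where nonsingularity of `K` enters the argument. -/
theorem modifiedContra_eq {x : E2} (hx : x ∈ P.immersionDomain)
    (hK : (P.curvatureMixed x).det ≠ 0) :
    P.modifiedContra x = (P.areaDensity x ^ 2)⁻¹ • (P.curvatureCov x).adjugate := by
  have hG := P.isUnit_det_metric hx
  have hB : (P.curvatureCov x).det ≠ 0 := by
    rw [curvatureMixed, Matrix.det_mul] at hK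
    exact right_ne_zero_of_mul hK
  rw [modifiedContra, curvatureMixed, Matrix.mul_inv_rev, Matrix.nonsing_inv_nonsing_inv _ hG,
    Matrix.mul_assoc, Matrix.mul_nonsing_inv _ hG, Matrix.mul_one, gaussCurvature, det_metric,
    Matrix.inv_def, Ring.inverse_eq_inv', smul_smul]
  congr 1
  field_simp

variable {V W : Type*} [NormedAddCommGroup V] [NormedSpace ℝ V] [AddCommGroup W] [Module ℝ W]

/-- The density, with respect to the coordinates, of the differential two-form
`dn ∘ dΦ` on the surface. -/
def formDensity (op : E3 →ₗ[ℝ] V →ₗ[ℝ] W) (Φ : E3 → V) (x : E2) : W :=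
  op (P.normalDeriv 0 x) (P.fieldDeriv Φ 1 x) - op (P.normalDeriv 1 x) (P.fieldDeriv Φ 0 x)

/-- Up to the factor `1 / |g₀ × g₁|`, the vector `L̂ⁱʲ n × gᵢ` is `∂₀n` for `j = 1` and `-∂₁n` for
`j = 0`. -/
theorem normalCrossGrad_eq (op : E3 →ₗ[ℝ] V →ₗ[ℝ] W) (Φ : E3 → V) {x : E2}
    (hx : x ∈ P.immersionDomain) (hK : (P.curvatureMixed x).det ≠ 0) :
    P.normalCrossGrad op Φ x = (P.areaDensity x)⁻¹ • P.formDensity op Φ x := by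
  have hJ := (P.areaDensity_pos hx).ne'
  have h0 : cross (P.unitNormal x) (P.tangent 0 x) = (P.areaDensity x)⁻¹ •
      (P.metric x 0 0 • P.tangent 1 x - P.metric x 0 1 • P.tangent 0 x) := by
    rw [unitNormal, cross_smul_left, cross_cross_left]; rfl
  have h1 : cross (P.unitNormal x) (P.tangent 1 x) = (P.areaDensity x)⁻¹ •
      (P.metric x 0 1 • P.tangent 1 x - P.metric x 1 1 • P.tangent 0 x) := by
    rw [unitNormal, cross_smul_left, cross_cross_right]; rfl
  have hm : ∀ i, P.normalDeriv i x = (P.areaDensity x ^ 2)⁻¹ •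
      (P.areaDensity x ^ 2 • P.normalDeriv i x) := fun i => by
    rw [smul_smul, inv_mul_cancel₀ (pow_ne_zero 2 hJ), one_smul]
  rw [normalCrossGrad, formDensity, hm 0, hm 1, P.areaDensity_sq_smul_normalDeriv hx,
    P.areaDensity_sq_smul_normalDeriv hx, P.modifiedContra_eq hx hK, Matrix.adjugate_fin_two]
  simp only [Fin.sum_univ_two, h0, h1, Matrix.smul_apply, Matrix.of_apply, Matrix.cons_val_zero,
    Matrix.cons_val_one, Matrix.cons_val_fin_one, P.curvatureCov_symm hx.1 1 0, smul_eq_mul, map_smul, map_sub, map_add,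
    LinearMap.smul_apply, LinearMap.sub_apply, LinearMap.add_apply]
  module

/-- By duality of `gⁱ` and `gⱼ` the contraction leaves `b₀ⱼ gʲ`, which is `-∂₀n` by Weingarten. -/
theorem curvatureTensor_tangent {x : E2} (hx : x ∈ P.immersionDomain) :
    P.curvatureTensor x (P.tangent 0 x) = -P.normalDeriv 0 x := by
  have hJ := (P.areaDensity_pos hx).ne'
  have hG := P.isUnit_det_metric hx
  have hc : ∀ i, inner ℝ (P.cotangent i x) (P.tangent 0 x) = if i = 0 then (1 : ℝ) else 0 := by
    intro i
    have := congrFun (congrFun (Matrix.nonsing_inv_mul _ hG) i) 0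
    rw [Matrix.mul_apply, Matrix.one_apply] at this
    rw [← this, cotangent, sum_inner]
    simp only [real_inner_smul_left, metric, Matrix.of_apply]
  have hinv : (P.metric x)⁻¹ = (P.areaDensity x ^ 2)⁻¹ • (P.metric x).adjugate := by
    rw [Matrix.inv_def, det_metric, Ring.inverse_eq_inv']
  have hm : P.normalDeriv 0 x = (P.areaDensity x ^ 2)⁻¹ •
      (P.areaDensity x ^ 2 • P.normalDeriv 0 x) := by
    rw [smul_smul, inv_mul_cancel₀ (pow_ne_zero 2 hJ), one_smul]
  rw [hm, P.areaDensity_sq_smul_normalDeriv hx]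
  simp only [curvatureTensor, LinearMap.add_apply, LinearMap.smul_apply, dyad,
    LinearMap.smulRight_apply, innerₗ_apply_apply, hc, Fin.sum_univ_two]
  simp only [cotangent, hinv, Matrix.adjugate_fin_two, Fin.sum_univ_two, Matrix.smul_apply,
    Matrix.of_apply, Matrix.cons_val_zero, Matrix.cons_val_one, Matrix.cons_val_fin_one,
    P.curvatureCov_symm hx.1 1 0, smul_eq_mul, P.metric_symm, if_true, one_ne_zero, if_false]
  module

end LocalParam

/-! ### The half-plane and changes of chart -/

theorem eq_sum_e (v : E2) : v = v 0 • e 0 + v 1 • e 1 := by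
  ext i; fin_cases i <;> simp

theorem map_eq_sum_e {F : Type*} [NormedAddCommGroup F] [NormedSpace ℝ F] (L : E2 →L[ℝ] F) (v : E2) :
    L v = v 0 • L (e 0) + v 1 • L (e 1) := by
  conv_lhs => rw [eq_sum_e v]
  simp only [map_add, map_smul]

theorem convex_halfPlane : Convex ℝ halfPlane := by
  intro x hx y hy a b ha hb _
  simp only [halfPlane, mem_ofPred_eq] at *
  simp only [PiLp.add_apply, PiLp.smul_apply, smul_eq_mul]
  positivity

theorem isClosed_halfPlane : IsClosed halfPlane :=
  isClosed_le continuous_const (by fun_prop)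

theorem isOpen_upperHalfPlane : IsOpen {x : E2 | 0 < x 1} :=
  isOpen_lt continuous_const (by fun_prop)

theorem upperHalfPlane_subset : {x : E2 | 0 < x 1} ⊆ halfPlane := fun _ hx =>
  le_of_lt (mem_ofPred.1 hx)

theorem uniqueDiffOn_halfPlane : UniqueDiffOn ℝ halfPlane :=
  uniqueDiffOn_convex convex_halfPlane
    ⟨e 1, interior_maximal upperHalfPlane_subset isOpen_upperHalfPlane (by simp)⟩

namespace LocalParam

variable {S : Set E3} (P Q : LocalParam S)

theorem uniqueDiffOn_paramDomain : UniqueDiffOn ℝ P.paramDomain := by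
  rw [paramDomain, inter_comm]
  exact uniqueDiffOn_halfPlane.inter P.isOpen_dom

theorem measurableSet_paramDomain : MeasurableSet P.paramDomain :=
  P.isOpen_dom.measurableSet.inter isClosed_halfPlane.measurableSet

variable {P} in
theorem toFun_mem {x : E2} (hx : x ∈ P.paramDomain) : P.toFun x ∈ S ∩ P.target :=
  P.image_eq ▸ mem_image_of_mem _ hx

variable {P} in
theorem coords_mem {p : E3} (hp : p ∈ S ∩ P.target) : P.coords p ∈ P.paramDomain := by
  obtain ⟨x, hx, rfl⟩ := P.image_eq.symm ▸ hp
  rw [P.coords_toFun x hx]; exact hx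

variable {P} in
theorem toFun_coords {p : E3} (hp : p ∈ S ∩ P.target) : P.toFun (P.coords p) = p := by
  obtain ⟨x, hx, rfl⟩ := P.image_eq.symm ▸ hp
  rw [P.coords_toFun x hx]

theorem injOn_toFun : InjOn P.toFun P.paramDomain := fun x hx y hy h => by
  rw [← P.coords_toFun x hx, ← P.coords_toFun y hy, h]

theorem continuousOn_toFun : ContinuousOn P.toFun P.dom := P.smooth.continuousOn

theorem hasStrictFDerivAt_toFun {x : E2} (hx : x ∈ P.dom) :
    HasStrictFDerivAt P.toFun (fderiv ℝ P.toFun x) x :=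
  (P.smooth.contDiffAt (P.isOpen_dom.mem_nhds hx)).hasStrictFDerivAt (by simp)

theorem fderiv_toFun_apply (x v : E2) :
    fderiv ℝ P.toFun x v = v 0 • P.tangent 0 x + v 1 • P.tangent 1 x := map_eq_sum_e _ _

theorem injective_fderiv {x : E2} (hx : x ∈ P.paramDomain) :
    Function.Injective (fderiv ℝ P.toFun x) := by
  refine (injective_iff_map_eq_zero _).2 fun v hv => ?_
  have h := P.regular x hx
  rw [fderiv_toFun_apply] at hv
  have := Fintype.linearIndependent_iff.1 h (fun i => v i) (by
    rw [Fin.sum_univ_two]; exact hv)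
  ext i; exact this i

/-- The inverse of a chart is only assumed continuous on the surface. With `L` a left inverse of the
derivative of `Q` at `y`, the map `L ∘ Q` is locally invertible in the plane, and `(L ∘ Q)⁻¹ ∘ L` is
an extension to space that is differentiable at the point. Continuity of `coords` keeps the
parameters where the local inverse applies. -/
theorem exists_coords_eventuallyEq {y : E2} (hy : y ∈ Q.paramDomain) :
    ∃ (ρ : E3 → E2) (ρ' : E3 →L[ℝ] E2), HasFDerivAt ρ ρ' (Q.toFun y) ∧
      Q.coords =ᶠ[𝓝[S] Q.toFun y] ρ := by
  obtain ⟨l, hl⟩ := LinearMap.exists_leftInverse_of_injective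
    (fderiv ℝ Q.toFun y : E2 →ₗ[ℝ] E3) (LinearMap.ker_eq_bot.2 (Q.injective_fderiv hy))
  set L : E3 →L[ℝ] E2 := LinearMap.toContinuousLinearMap l
  have hLQ : L ∘L fderiv ℝ Q.toFun y = (ContinuousLinearEquiv.refl ℝ E2 : E2 →L[ℝ] E2) := by
    ext1 v
    exact LinearMap.congr_fun hl v
  have hs : HasStrictFDerivAt (L ∘ Q.toFun) (ContinuousLinearEquiv.refl ℝ E2 : E2 →L[ℝ] E2) y := by
    rw [← hLQ]
    exact L.hasStrictFDerivAt.comp y (Q.hasStrictFDerivAt_toFun hy.1)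
  refine ⟨fun p => hs.localInverse _ _ _ (L p), _,
    HasFDerivAt.comp (Q.toFun y) (f := L) hs.to_localInverse.hasFDerivAt L.hasFDerivAt, ?_⟩
  have hp := toFun_mem hy
  have hcont : Tendsto Q.coords (𝓝[S] Q.toFun y) (𝓝 y) := by
    have := Q.continuousOn_coords _ hp
    rw [ContinuousWithinAt, Q.coords_toFun y hy,
      nhdsWithin_inter_of_mem' (mem_nhdsWithin_of_mem_nhds (Q.isOpen_target.mem_nhds hp.2))] at this
    exact this
  filter_upwards [hcont.eventually hs.eventually_left_inverse, self_mem_nhdsWithin,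
    mem_nhdsWithin_of_mem_nhds (Q.isOpen_target.mem_nhds hp.2)] with p h1 h2 h3
  simp only [Function.comp_apply, toFun_coords ⟨h2, h3⟩] at h1
  exact h1.symm

/-- `A` is the derivative at `x` of the transition map from the chart `P` to the chart `Q`. -/
structure IsTransition (x : E2) (A : E2 →L[ℝ] E2) : Prop where
  mem : x ∈ P.paramDomain
  mem_target : P.toFun x ∈ Q.target
  hasFDerivWithinAt : HasFDerivWithinAt (Q.coords ∘ P.toFun) A P.paramDomain x
  fderiv_eq : fderiv ℝ P.toFun x = fderiv ℝ Q.toFun (Q.coords (P.toFun x)) ∘L A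

theorem tendsto_toFun {x : E2} (hx : x ∈ P.paramDomain) :
    Tendsto P.toFun (𝓝[P.paramDomain] x) (𝓝[S] P.toFun x) :=
  tendsto_nhdsWithin_of_tendsto_nhds_of_eventually_within _
    ((P.continuousOn_toFun.mono inter_subset_left) x hx)
    (eventually_mem_nhdsWithin.mono fun _ hz => (toFun_mem hz).1)

theorem eventually_mem_target {x : E2} (hx : x ∈ P.paramDomain) (hQ : P.toFun x ∈ Q.target) :
    ∀ᶠ z in 𝓝[P.paramDomain] x, P.toFun z ∈ S ∩ Q.target := by
  have := (P.tendsto_toFun hx).eventually (inter_mem self_mem_nhdsWithin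
    (mem_nhdsWithin_of_mem_nhds (Q.isOpen_target.mem_nhds hQ)))
  exact this

theorem exists_isTransition {x : E2} (hx : x ∈ P.paramDomain) (hQ : P.toFun x ∈ Q.target) :
    ∃ A, IsTransition P Q x A := by
  have hp : P.toFun x ∈ S ∩ Q.target := ⟨(toFun_mem hx).1, hQ⟩
  have hy := coords_mem hp
  obtain ⟨ρ, ρ', hρ, heq⟩ := Q.exists_coords_eventuallyEq hy
  rw [toFun_coords hp] at hρ heq
  have hP := (P.differentiableAt_toFun hx.1).hasFDerivAt.hasFDerivWithinAt (s := P.paramDomain)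
  have hψ : HasFDerivWithinAt (Q.coords ∘ P.toFun) (ρ' ∘L fderiv ℝ P.toFun x) P.paramDomain x :=
    (hρ.comp_hasFDerivWithinAt x hP).congr_of_eventuallyEq
      ((P.tendsto_toFun hx).eventually heq)
      (heq.eq_of_nhdsWithin (toFun_mem hx).1)
  refine ⟨_, hx, hQ, hψ, ?_⟩
  -- Near `x`, `P` equals `Q` after the transition map; derivatives within the parameter domain are
  -- unique, also on the boundary line.
  refine (P.uniqueDiffOn_paramDomain x hx).eq hP ?_
  refine (((Q.differentiableAt_toFun hy.1).hasFDerivAt).comp_hasFDerivWithinAt x hψ).congr_of_eventuallyEq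
    ?_ (toFun_coords hp).symm
  filter_upwards [P.eventually_mem_target Q hx hQ] with z hz
  exact (toFun_coords hz).symm

variable {P Q}

namespace IsTransition

variable {x : E2} {A : E2 →L[ℝ] E2}

theorem mem' (h : IsTransition P Q x A) : P.toFun x ∈ S ∩ Q.target :=
  ⟨(toFun_mem h.mem).1, h.mem_target⟩

theorem coords_mem (h : IsTransition P Q x A) : Q.coords (P.toFun x) ∈ Q.paramDomain :=
  LocalParam.coords_mem h.mem'

theorem hasFDerivWithinAt_comp (h : IsTransition P Q x A) {Z : Type*} [NormedAddCommGroup Z]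
    [NormedSpace ℝ Z] {G : E3 → Z} {B : E2 →L[ℝ] Z}
    (hG : HasFDerivWithinAt (fun y => G (Q.toFun y)) B Q.paramDomain (Q.coords (P.toFun x))) :
    HasFDerivWithinAt (fun z => G (P.toFun z)) (B ∘L A) P.paramDomain x := by
  have hev := P.eventually_mem_target Q h.mem h.mem_target
  have := hG.comp_of_tendsto x h.hasFDerivWithinAt
    (tendsto_nhdsWithin_of_tendsto_nhds_of_eventually_within _
      h.hasFDerivWithinAt.continuousWithinAt (hev.mono fun z hz => LocalParam.coords_mem hz))
  refine this.congr_of_eventuallyEq (hev.mono fun z hz => ?_) ?_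
  · simp only [Function.comp_apply, toFun_coords hz]
  · simp only [Function.comp_apply, toFun_coords h.mem']

theorem tangent_eq (h : IsTransition P Q x A) (i : Fin 2) :
    P.tangent i x = A (e i) 0 • Q.tangent 0 (Q.coords (P.toFun x)) +
      A (e i) 1 • Q.tangent 1 (Q.coords (P.toFun x)) := by
  rw [← fderiv_toFun_apply, tangent, h.fderiv_eq]; rfl

theorem cross_eq (h : IsTransition P Q x A) :
    cross (P.tangent 0 x) (P.tangent 1 x) =
      (A (e 0) 0 * A (e 1) 1 - A (e 0) 1 * A (e 1) 0) •
        cross (Q.tangent 0 (Q.coords (P.toFun x))) (Q.tangent 1 (Q.coords (P.toFun x))) := by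
  rw [h.tangent_eq 0, h.tangent_eq 1, cross_combination]

theorem det_ne_zero (h : IsTransition P Q x A) :
    A (e 0) 0 * A (e 1) 1 - A (e 0) 1 * A (e 1) 0 ≠ 0 := fun h0 =>
  P.cross_tangent_ne_zero h.mem (by rw [h.cross_eq, h0, zero_smul])

theorem fieldDeriv_eq (h : IsTransition P Q x A) {V : Type*} [NormedAddCommGroup V]
    [NormedSpace ℝ V] {Φ : E3 → V}
    (hΦ : DifferentiableWithinAt ℝ (fun y => Φ (Q.toFun y)) Q.paramDomain (Q.coords (P.toFun x)))
    (i : Fin 2) :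
    P.fieldDeriv Φ i x = A (e i) 0 • Q.fieldDeriv Φ 0 (Q.coords (P.toFun x)) +
      A (e i) 1 • Q.fieldDeriv Φ 1 (Q.coords (P.toFun x)) := by
  have := (h.hasFDerivWithinAt_comp hΦ.hasFDerivWithinAt).fderivWithin
    (P.uniqueDiffOn_paramDomain x h.mem)
  rw [fieldDeriv, fieldDeriv, fieldDeriv]
  change fderivWithin ℝ _ P.paramDomain x _ = _ • fderivWithin ℝ _ Q.paramDomain _ _ +
    _ • fderivWithin ℝ _ Q.paramDomain _ _
  rw [this, ← map_eq_sum_e]; rfl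

end IsTransition

theorem mem_posTangentConeAt_paramDomain {x v : E2} (hx : x ∈ P.paramDomain)
    (hv : 0 < x 1 ∨ 0 ≤ v 1) : v ∈ posTangentConeAt P.paramDomain x := by
  refine mem_posTangentConeAt_of_frequently_mem (Eventually.frequently ?_)
  have hc : Tendsto (fun t : ℝ => x + t • v) (𝓝[>] 0) (𝓝 x) := by
    have : Continuous fun t : ℝ => x + t • v := by fun_prop
    simpa using (this.tendsto 0).mono_left (nhdsWithin_le_nhds (s := Ioi 0))
  have h1 := hc.eventually (P.isOpen_dom.mem_nhds hx.1)
  rcases hv with hv | hv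
  · filter_upwards [h1, hc.eventually (isOpen_upperHalfPlane.mem_nhds hv)] with t ht ht'
    exact ⟨ht, upperHalfPlane_subset ht'⟩
  · filter_upwards [h1, self_mem_nhdsWithin] with t ht ht'
    refine ⟨ht, ?_⟩
    have h2 : 0 ≤ x 1 := hx.2
    have h3 : (0 : ℝ) < t := ht'
    simp only [halfPlane, mem_ofPred_eq, PiLp.add_apply, PiLp.smul_apply, smul_eq_mul]
    positivity

namespace IsTransition

variable {x : E2} {A : E2 →L[ℝ] E2}

/-- If `x` goes to the boundary line, the second coordinate of the transition map has a local
minimum there; this is the first-order condition in the admissible directions. -/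
theorem nonneg_of_boundary (h : IsTransition P Q x A) (hy : Q.coords (P.toFun x) 1 = 0) {v : E2}
    (hv : 0 < x 1 ∨ 0 ≤ v 1) : 0 ≤ A v 1 := by
  have hmin : IsLocalMinOn (fun z => (Q.coords ∘ P.toFun) z 1) P.paramDomain x := by
    filter_upwards [P.eventually_mem_target Q h.mem h.mem_target] with z hz
    simp only [Function.comp_apply, hy]
    exact (LocalParam.coords_mem hz).2
  have hd : HasFDerivWithinAt (fun z => (Q.coords ∘ P.toFun) z 1)
      ((EuclideanSpace.proj (1 : Fin 2) : E2 →L[ℝ] ℝ) ∘L A) P.paramDomain x :=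
    (EuclideanSpace.proj (1 : Fin 2) : E2 →L[ℝ] ℝ).hasFDerivAt.comp_hasFDerivWithinAt x
      h.hasFDerivWithinAt
  exact hmin.hasFDerivWithinAt_nonneg hd (mem_posTangentConeAt_paramDomain h.mem hv)

theorem apply_e_zero_of_boundary (h : IsTransition P Q x A) (hy : Q.coords (P.toFun x) 1 = 0) :
    A (e 0) 1 = 0 := by
  have h1 := h.nonneg_of_boundary hy (v := e 0) (Or.inr (by simp))
  have h2 := h.nonneg_of_boundary hy (v := -e 0) (Or.inr (by simp))
  rw [map_neg, PiLp.neg_apply] at h2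
  linarith

/-- At an interior point both `v` and `-v` are admissible, so the second row of `A` would vanish,
against `det A ≠ 0`. Invariance of domain is not needed. -/
theorem boundary_of_boundary (h : IsTransition P Q x A) (hy : Q.coords (P.toFun x) 1 = 0) :
    x 1 = 0 := by
  by_contra hx
  have hx' : 0 < x 1 := lt_of_le_of_ne h.mem.2 (Ne.symm hx)
  have h1 := h.nonneg_of_boundary hy (v := e 1) (Or.inl hx')
  have h2 := h.nonneg_of_boundary hy (v := -e 1) (Or.inl hx')
  rw [map_neg, PiLp.neg_apply] at h2
  have h3 : A (e 1) 1 = 0 := by linarith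
  exact h.det_ne_zero (by rw [h3, h.apply_e_zero_of_boundary hy]; ring)

end IsTransition

theorem coords_boundary_iff {p : E3} (hP : p ∈ S ∩ P.target) (hQ : p ∈ S ∩ Q.target) :
    P.coords p 1 = 0 ↔ Q.coords p 1 = 0 := by
  have key : ∀ {P Q : LocalParam S}, p ∈ S ∩ P.target → p ∈ S ∩ Q.target →
      Q.coords p 1 = 0 → P.coords p 1 = 0 := by
    intro P Q hP hQ h
    obtain ⟨A, hA⟩ := P.exists_isTransition Q (coords_mem hP) (by rw [toFun_coords hP]; exact hQ.2)
    exact hA.boundary_of_boundary (by rw [toFun_coords hP]; exact h)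
  exact ⟨key hQ hP, key hP hQ⟩

/-- The unit normal of the chart is the restriction of a given field. -/
def HasNormal (P : LocalParam S) (N : E3 → E3) : Prop :=
  ∀ x ∈ P.paramDomain, P.unitNormal x = N (P.toFun x)

/-- Reads the derivative of the normal as that of a field on the surface, so it transforms between
charts as `Φ` does. -/
theorem normalDeriv_eq_fieldDeriv {N : E3 → E3} (hP : P.HasNormal N) {x : E2}
    (hx : x ∈ P.paramDomain) (i : Fin 2) : P.normalDeriv i x = P.fieldDeriv N i x := by
  have hd := P.differentiableAt_unitNormal (P.paramDomain_subset hx)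
  rw [normalDeriv, ← fderivWithin_eq_fderiv (P.uniqueDiffOn_paramDomain x hx) hd, fieldDeriv]
  exact congrArg (fun L : E2 →L[ℝ] E3 => L (e i)) (fderivWithin_congr (fun y hy => hP y hy) (hP x hx))

theorem differentiableWithinAt_normal {N : E3 → E3} (hP : P.HasNormal N) {x : E2}
    (hx : x ∈ P.paramDomain) :
    DifferentiableWithinAt ℝ (fun y => N (P.toFun y)) P.paramDomain x :=
  (P.differentiableAt_unitNormal (P.paramDomain_subset hx)).differentiableWithinAt.congr
    (fun y hy => (hP y hy).symm) (hP x hx).symm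

namespace IsTransition

variable {x : E2} {A : E2 →L[ℝ] E2} {N : E3 → E3}

theorem normalDeriv_eq (h : IsTransition P Q x A) (hP : P.HasNormal N) (hQ : Q.HasNormal N)
    (i : Fin 2) :
    P.normalDeriv i x = A (e i) 0 • Q.normalDeriv 0 (Q.coords (P.toFun x)) +
      A (e i) 1 • Q.normalDeriv 1 (Q.coords (P.toFun x)) := by
  rw [normalDeriv_eq_fieldDeriv hP h.mem, normalDeriv_eq_fieldDeriv hQ h.coords_mem,
    normalDeriv_eq_fieldDeriv hQ h.coords_mem,
    h.fieldDeriv_eq (differentiableWithinAt_normal hQ h.coords_mem)]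

/-- `g₀ × g₁` is multiplied by `det A`, while its direction is the common normal in both charts. -/
theorem det_pos (h : IsTransition P Q x A) (hP : P.HasNormal N) (hQ : Q.HasNormal N) :
    0 < A (e 0) 0 * A (e 1) 1 - A (e 0) 1 * A (e 1) 0 := by
  by_contra hneg
  have hJP := P.areaDensity_pos (P.paramDomain_subset h.mem)
  have hJQ := Q.areaDensity_pos (Q.paramDomain_subset h.coords_mem)
  have hn := hQ _ h.coords_mem
  rw [toFun_coords h.mem', ← hP x h.mem] at hn
  have h1 : cross (P.tangent 0 x) (P.tangent 1 x) = P.areaDensity x • P.unitNormal x := by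
    exact (smul_inv_smul₀ hJP.ne' _).symm
  have h2 := h.cross_eq
  have h3 : cross (Q.tangent 0 (Q.coords (P.toFun x))) (Q.tangent 1 (Q.coords (P.toFun x))) =
      Q.areaDensity (Q.coords (P.toFun x)) • P.unitNormal x := by
    rw [← hn]
    exact (smul_inv_smul₀ hJQ.ne' _).symm
  rw [h1, h3, smul_smul] at h2
  have hne : P.unitNormal x ≠ 0 := by
    rw [← norm_ne_zero_iff, P.norm_unitNormal (P.paramDomain_subset h.mem)]; exact one_ne_zero
  have := smul_left_injective ℝ hne h2
  nlinarith

theorem areaDensity_eq (h : IsTransition P Q x A) (hP : P.HasNormal N) (hQ : Q.HasNormal N) :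
    P.areaDensity x = (A (e 0) 0 * A (e 1) 1 - A (e 0) 1 * A (e 1) 0) *
      Q.areaDensity (Q.coords (P.toFun x)) := by
  rw [areaDensity, h.cross_eq, norm_smul, Real.norm_of_nonneg (h.det_pos hP hQ).le]; rfl

variable {V W : Type*} [NormedAddCommGroup V] [NormedSpace ℝ V] [AddCommGroup W] [Module ℝ W]

/-- Both `dn ∧ dΦ` and the area element are multiplied by `det A`, which cancels. -/
theorem formDensity_eq (h : IsTransition P Q x A) (hP : P.HasNormal N) (hQ : Q.HasNormal N)
    (op : E3 →ₗ[ℝ] V →ₗ[ℝ] W) {Φ : E3 → V}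
    (hΦ : DifferentiableWithinAt ℝ (fun y => Φ (Q.toFun y)) Q.paramDomain (Q.coords (P.toFun x))) :
    (P.areaDensity x)⁻¹ • P.formDensity op Φ x =
      (Q.areaDensity (Q.coords (P.toFun x)))⁻¹ • Q.formDensity op Φ (Q.coords (P.toFun x)) := by
  have hdet := (h.det_pos hP hQ).ne'
  have hf : P.formDensity op Φ x = (A (e 0) 0 * A (e 1) 1 - A (e 0) 1 * A (e 1) 0) •
      Q.formDensity op Φ (Q.coords (P.toFun x)) := by
    simp only [formDensity, h.normalDeriv_eq hP hQ, h.fieldDeriv_eq hΦ, map_add, map_smul,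
      LinearMap.add_apply, LinearMap.smul_apply]
    module
  rw [hf, h.areaDensity_eq hP hQ, mul_inv, mul_comm, mul_smul, smul_smul _ _ (Q.formDensity op Φ _),
    inv_mul_cancel₀ hdet, one_smul]

/-- At a boundary point `A (e 0)` is a positive multiple of `e 0`: its second component vanishes,
and `det A > 0` with `A (e 1) 1 ≥ 0` gives the sign. The multiple cancels in the quotient. -/
theorem boundary_term_eq (h : IsTransition P Q x A) (hP : P.HasNormal N) (hQ : Q.HasNormal N)
    (hy : Q.coords (P.toFun x) 1 = 0) :
    ‖P.tangent 0 x‖⁻¹ • P.normalDeriv 0 x =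
      ‖Q.tangent 0 (Q.coords (P.toFun x))‖⁻¹ • Q.normalDeriv 0 (Q.coords (P.toFun x)) := by
  have h0 := h.apply_e_zero_of_boundary hy
  have hdet := h.det_pos hP hQ
  have h1 := h.nonneg_of_boundary hy (v := e 1) (Or.inr (by simp))
  rw [h0, zero_mul, sub_zero] at hdet
  have hpos : 0 < A (e 0) 0 := pos_of_mul_pos_left hdet h1
  rw [h.tangent_eq 0, h.normalDeriv_eq hP hQ 0, h0, zero_smul, zero_smul, add_zero, add_zero,
    norm_smul, Real.norm_of_nonneg hpos.le, mul_inv, smul_smul, mul_right_comm,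
    inv_mul_cancel₀ hpos.ne', one_mul]

end IsTransition

end LocalParam

/-! ### The divergence theorem on the half-plane -/

theorem integrableOn_of_eq_zero_off_compact {X G : Type*} [TopologicalSpace X] [T2Space X]
    [MeasurableSpace X] [OpensMeasurableSpace X] [TopologicalSpace.PseudoMetrizableSpace X] {μ : Measure X}
    [IsFiniteMeasureOnCompacts μ]
    [NormedAddCommGroup G] {f : X → G} {s K : Set X} (hK : IsCompact K) (hKs : K ⊆ s)
    (hs : MeasurableSet s) (hf : ContinuousOn f s) (h0 : ∀ x ∈ s \ K, f x = 0) :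
    IntegrableOn f s μ :=
  ((hf.mono hKs).integrableOn_compact hK).of_forall_sdiff_eq_zero hs h0

section HalfPlane

variable {W : Type*} [NormedAddCommGroup W] [NormedSpace ℝ W] {U K : Set E2} {G : E2 → W}

omit [NormedSpace ℝ W] in
theorem indicator_eq_zero_of_notMem (h0 : ∀ x ∈ (U ∩ halfPlane) \ K, G x = 0) {x : E2}
    (hx : x ∉ K) : (U ∩ halfPlane).indicator G x = 0 := by
  by_cases h : x ∈ U ∩ halfPlane
  · rw [indicator_of_mem h, h0 x ⟨h, hx⟩]
  · exact indicator_of_notMem h _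

omit [NormedSpace ℝ W] in
theorem continuousOn_indicator_halfPlane (hU : IsOpen U) (hK : IsCompact K)
    (hKU : K ⊆ U ∩ halfPlane) (h0 : ∀ x ∈ (U ∩ halfPlane) \ K, G x = 0)
    (hG : ContinuousOn G (U ∩ halfPlane)) :
    ContinuousOn ((U ∩ halfPlane).indicator G) halfPlane := by
  intro x hx
  by_cases hxU : x ∈ U
  · have hmem : U ∩ halfPlane ∈ 𝓝[halfPlane] x :=
      inter_mem (mem_nhdsWithin_of_mem_nhds (hU.mem_nhds hxU)) self_mem_nhdsWithin
    have h1 := hG x ⟨hxU, hx⟩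
    rw [ContinuousWithinAt, inter_comm,
      nhdsWithin_inter_of_mem' (mem_nhdsWithin_of_mem_nhds (hU.mem_nhds hxU))] at h1
    refine ContinuousWithinAt.congr_of_eventuallyEq h1 ?_
      (indicator_of_mem (show x ∈ U ∩ halfPlane from ⟨hxU, hx⟩) _)
    filter_upwards [hmem] with z hz using indicator_of_mem hz _
  · have hxK : x ∉ K := fun h => hxU (hKU h).1
    refine (continuousWithinAt_const (b := (0 : W))).congr_of_eventuallyEq ?_
      (indicator_eq_zero_of_notMem h0 hxK)
    filter_upwards [mem_nhdsWithin_of_mem_nhds (hK.isClosed.isOpen_compl.mem_nhds hxK)] with z hz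
      using indicator_eq_zero_of_notMem h0 hz

theorem hasFDerivAt_indicator_halfPlane (hU : IsOpen U) (hK : IsCompact K)
    (hKU : K ⊆ U ∩ halfPlane) (h0 : ∀ x ∈ (U ∩ halfPlane) \ K, G x = 0)
    (hG : DifferentiableOn ℝ G (U ∩ halfPlane)) {x : E2} (hx : 0 < x 1) :
    HasFDerivAt ((U ∩ halfPlane).indicator G)
      ((U ∩ halfPlane).indicator (fderivWithin ℝ G (U ∩ halfPlane)) x) x := by
  have hxH := upperHalfPlane_subset hx
  by_cases hxU : x ∈ U
  · have hmem : U ∩ halfPlane ∈ 𝓝 x := inter_mem (hU.mem_nhds hxU)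
      (mem_of_superset (isOpen_upperHalfPlane.mem_nhds hx) upperHalfPlane_subset)
    rw [indicator_of_mem (show x ∈ U ∩ halfPlane from ⟨hxU, hxH⟩)]
    refine ((hG x ⟨hxU, hxH⟩).hasFDerivWithinAt.hasFDerivAt hmem).congr_of_eventuallyEq ?_
    filter_upwards [hmem] with z hz using indicator_of_mem hz _
  · have hxK : x ∉ K := fun h => hxU (hKU h).1
    rw [indicator_of_notMem (fun h => hxU h.1)]
    refine (hasFDerivAt_const (0 : W) x).congr_of_eventuallyEq ?_
    filter_upwards [hK.isClosed.isOpen_compl.mem_nhds hxK] with z hz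
      using indicator_eq_zero_of_notMem h0 hz

theorem fderivWithin_eq_zero_off_compact (hK : IsCompact K)
    (h0 : ∀ x ∈ (U ∩ halfPlane) \ K, G x = 0) {x : E2} (hx : x ∈ (U ∩ halfPlane) \ K) :
    fderivWithin ℝ G (U ∩ halfPlane) x = 0 := by
  have : G =ᶠ[𝓝[U ∩ halfPlane] x] fun _ => 0 := by
    filter_upwards [self_mem_nhdsWithin,
      mem_nhdsWithin_of_mem_nhds (hK.isClosed.isOpen_compl.mem_nhds hx.2)] with z hz hz'
      using h0 z ⟨hz, hz'⟩
  rw [this.fderivWithin_eq (h0 x hx)]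
  simp

/-- The plane as a product. -/
def planeEquiv : (ℝ × ℝ) ≃L[ℝ] E2 :=
  (ContinuousLinearEquiv.finTwoArrow ℝ ℝ).symm.trans (EuclideanSpace.equiv (Fin 2) ℝ).symm

theorem planeEquiv_apply (a b : ℝ) : planeEquiv (a, b) = a • e 0 + b • e 1 := by
  rw [eq_sum_e (planeEquiv (a, b))]; rfl

theorem measurePreserving_planeEquiv : MeasurePreserving planeEquiv volume volume :=
  (PiLp.volume_preserving_toLp (Fin 2)).comp (volume_preserving_finTwoArrow ℝ).symm

/-- The divergence theorem for compactly supported fields on an open subset of the half-plane. -/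
theorem integral_divergence_halfPlane [CompleteSpace W] {G₀ G₁ : E2 → W} (hU : IsOpen U)
    (hK : IsCompact K) (hKU : K ⊆ U ∩ halfPlane)
    (h0 : ∀ x ∈ (U ∩ halfPlane) \ K, G₀ x = 0) (h1 : ∀ x ∈ (U ∩ halfPlane) \ K, G₁ x = 0)
    (hG₀ : ContDiffOn ℝ 1 G₀ (U ∩ halfPlane)) (hG₁ : ContDiffOn ℝ 1 G₁ (U ∩ halfPlane)) :
    ∫ x in U ∩ halfPlane, (fderivWithin ℝ G₀ (U ∩ halfPlane) x (e 0) +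
        fderivWithin ℝ G₁ (U ∩ halfPlane) x (e 1)) =
      -∫ t in {t : ℝ | t • e 0 ∈ U}, G₁ (t • e 0) := by
  set D := U ∩ halfPlane with hD
  have hDm : MeasurableSet D := hU.measurableSet.inter isClosed_halfPlane.measurableSet
  have hDu : UniqueDiffOn ℝ D := by
    rw [hD, inter_comm]; exact uniqueDiffOn_halfPlane.inter hU
  obtain ⟨R, hR0, hR⟩ : ∃ R : ℝ, 0 < R ∧ ∀ x ∈ K, ‖x‖ < R := by
    obtain ⟨R, hR⟩ := hK.isBounded.exists_norm_le
    exact ⟨max R 0 + 1, by positivity, fun x hx => by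
      have := hR x hx
      have := le_max_left R 0
      linarith⟩
  have hKR : ∀ p : ℝ × ℝ, planeEquiv p ∈ K → |p.1| < R ∧ |p.2| < R := fun p hp =>
    ⟨(PiLp.norm_apply_le (planeEquiv p) 0).trans_lt (hR _ hp),
      (PiLp.norm_apply_le (planeEquiv p) 1).trans_lt (hR _ hp)⟩
  set δ : E2 → W := D.indicator fun x => fderivWithin ℝ G₀ D x (e 0) + fderivWithin ℝ G₁ D x (e 1)
    with hδ
  have hδ0 : ∀ x ∉ K, δ x = 0 := fun x hx => by
    refine indicator_eq_zero_of_notMem (fun z hz => ?_) hx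
    rw [fderivWithin_eq_zero_off_compact hK h0 hz, fderivWithin_eq_zero_off_compact hK h1 hz]
    simp
  have hcd : ∀ G : E2 → W, ContDiffOn ℝ 1 G D → ContinuousOn (fderivWithin ℝ G D) D :=
    fun G hG => hG.continuousOn_fderivWithin hDu le_rfl
  have hδi : Integrable δ := by
    rw [hδ, integrable_indicator_iff hDm]
    refine integrableOn_of_eq_zero_off_compact hK hKU hDm
      (((hcd _ hG₀).clm_apply continuousOn_const).add ((hcd _ hG₁).clm_apply continuousOn_const))
      fun z hz => ?_
    rw [fderivWithin_eq_zero_off_compact hK h0 hz, fderivWithin_eq_zero_off_compact hK h1 hz]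
    simp
  have hδp : Integrable (fun p => δ (planeEquiv p)) :=
    (measurePreserving_planeEquiv.integrable_comp_emb
      planeEquiv.toHomeomorph.measurableEmbedding).2 hδi
  -- The fields, extended by zero, are integrated over `[-R, R] × [0, R]`. Differentiability is
  -- needed only in the open box, so continuity up to the line `x 1 = 0` suffices.
  have hbox := integral_divergence_prod_Icc_of_hasFDerivAt_off_countable_of_le
    (fun p => D.indicator G₀ (planeEquiv p)) (fun p => D.indicator G₁ (planeEquiv p))
    (fun p => D.indicator (fderivWithin ℝ G₀ D) (planeEquiv p) ∘L (planeEquiv : (ℝ × ℝ) →L[ℝ] E2))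
    (fun p => D.indicator (fderivWithin ℝ G₁ D) (planeEquiv p) ∘L (planeEquiv : (ℝ × ℝ) →L[ℝ] E2))
    (-R, 0) (R, R) ⟨by simp; linarith, by simp; linarith⟩ ∅ countable_empty
    ((continuousOn_indicator_halfPlane hU hK hKU h0 hG₀.continuousOn).comp
      planeEquiv.continuous.continuousOn fun p hp => hp.1.2)
    ((continuousOn_indicator_halfPlane hU hK hKU h1 hG₁.continuousOn).comp
      planeEquiv.continuous.continuousOn fun p hp => hp.1.2)
    (fun p hp => (hasFDerivAt_indicator_halfPlane hU hK hKU h0 (hG₀.differentiableOn one_ne_zero)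
      (x := planeEquiv p) hp.1.2.1).comp p planeEquiv.hasFDerivAt)
    (fun p hp => (hasFDerivAt_indicator_halfPlane hU hK hKU h1 (hG₁.differentiableOn one_ne_zero)
      (x := planeEquiv p) hp.1.2.1).comp p planeEquiv.hasFDerivAt)
  have hint : (fun p : ℝ × ℝ => (D.indicator (fderivWithin ℝ G₀ D) (planeEquiv p) ∘L
        (planeEquiv : (ℝ × ℝ) →L[ℝ] E2)) (1, 0) + (D.indicator (fderivWithin ℝ G₁ D) (planeEquiv p) ∘L
        (planeEquiv : (ℝ × ℝ) →L[ℝ] E2)) (0, 1)) = fun p => δ (planeEquiv p) := by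
    ext p
    have e0 : planeEquiv (1, 0) = e 0 := by simp [planeEquiv_apply]
    have e1 : planeEquiv (0, 1) = e 1 := by simp [planeEquiv_apply]
    by_cases hp : planeEquiv p ∈ D
    · simp [hδ, indicator_of_mem hp, e0, e1]
    · simp [hδ, indicator_of_notMem hp]
  rw [hint] at hbox
  replace hbox := hbox hδp.integrableOn
  have hz : ∀ G : E2 → W, (∀ x ∈ D \ K, G x = 0) → ∀ p : ℝ × ℝ, R ≤ |p.1| ∨ R ≤ |p.2| →
      D.indicator G (planeEquiv p) = 0 := fun G hG p hp =>
    indicator_eq_zero_of_notMem hG fun hpK => by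
      have := hKR p hpK
      rcases hp with hp | hp <;> linarith [this.1, this.2]
  -- Three faces of the box miss the support; the bottom face remains, with outward normal `-e 1`,
  -- hence the minus sign.
  have z1 : ∀ t : ℝ, D.indicator G₁ (planeEquiv (t, R)) = 0 := fun t =>
    hz G₁ h1 _ (Or.inr (le_abs_self R))
  have z2 : ∀ t : ℝ, D.indicator G₀ (planeEquiv (R, t)) = 0 := fun t =>
    hz G₀ h0 _ (Or.inl (le_abs_self R))
  have z3 : ∀ t : ℝ, D.indicator G₀ (planeEquiv (-R, t)) = 0 := fun t =>
    hz G₀ h0 _ (Or.inl (by simpa using le_abs_self R))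
  simp only [z1, z2, z3, intervalIntegral.integral_zero, zero_sub, add_zero, sub_zero] at hbox
  have hlhs : ∫ p in Icc ((-R, 0) : ℝ × ℝ) (R, R), δ (planeEquiv p) = ∫ x in D,
      (fderivWithin ℝ G₀ D x (e 0) + fderivWithin ℝ G₁ D x (e 1)) := by
    rw [setIntegral_eq_integral_of_forall_compl_eq_zero, measurePreserving_planeEquiv.integral_comp
      planeEquiv.toHomeomorph.measurableEmbedding, hδ, integral_indicator hDm]
    intro p hp
    refine hδ0 _ fun hpK => hp ?_
    have h2 : 0 ≤ p.2 := (hKU hpK).2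
    obtain ⟨h3, h4⟩ := hKR p hpK
    rw [abs_lt] at h3 h4
    exact ⟨⟨h3.1.le, h2⟩, ⟨h3.2.le, h4.2.le⟩⟩
  have hline : ∀ t : ℝ, planeEquiv (t, 0) = t • e 0 := fun t => by simp [planeEquiv_apply]
  have hrhs : ∫ t in -R..R, D.indicator G₁ (planeEquiv (t, 0)) =
      ∫ t in {t : ℝ | t • e 0 ∈ U}, G₁ (t • e 0) := by
    have hUm : MeasurableSet {t : ℝ | t • e 0 ∈ U} :=
      (hU.preimage (by fun_prop : Continuous fun t : ℝ => t • e 0)).measurableSet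
    rw [intervalIntegral.integral_of_le (by linarith), setIntegral_eq_integral_of_forall_compl_eq_zero,
      ← integral_indicator hUm]
    · refine integral_congr_ae (Eventually.of_forall fun t => ?_)
      have hH : t • e 0 ∈ halfPlane := by simp [halfPlane]
      by_cases ht : t • e 0 ∈ U
      · simp only [hline]
        rw [indicator_of_mem (show t • e 0 ∈ D from ⟨ht, hH⟩), indicator_of_mem (by exact ht)]
      · simp only [hline]
        rw [indicator_of_notMem (show t • e 0 ∉ D from fun h => ht h.1), indicator_of_notMem (by exact ht)]
    · intro t ht
      refine hz G₁ h1 _ (Or.inl ?_)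
      by_contra hlt
      rw [not_le, abs_lt] at hlt
      exact ht ⟨hlt.1, hlt.2.le⟩
  rw [← hlhs, hbox, hrhs]

end HalfPlane

/-! ### Stokes' theorem in one chart -/

namespace LocalParam

variable {S : Set E3} {P : LocalParam S} {V W : Type*} [NormedAddCommGroup V] [NormedSpace ℝ V]
  [FiniteDimensional ℝ V] [NormedAddCommGroup W] [NormedSpace ℝ W] [FiniteDimensional ℝ W]

omit [FiniteDimensional ℝ V] [FiniteDimensional ℝ W] [NormedAddCommGroup W] [NormedSpace ℝ W] in
theorem continuousOn_fieldDeriv {Φ : E3 → V}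
    (hΦ : ContDiffOn ℝ 1 (fun x => Φ (P.toFun x)) P.paramDomain) (i : Fin 2) :
    ContinuousOn (P.fieldDeriv Φ i) P.paramDomain :=
  (hΦ.continuousOn_fderivWithin P.uniqueDiffOn_paramDomain le_rfl).clm_apply continuousOn_const

omit [FiniteDimensional ℝ W] in
theorem contDiffOn_op (op : E3 →ₗ[ℝ] V →ₗ[ℝ] W) {Φ : E3 → V}
    (hΦ : ContDiffOn ℝ 1 (fun x => Φ (P.toFun x)) P.paramDomain) (i : Fin 2) :
    ContDiffOn ℝ 1 (fun x => op (P.normalDeriv i x) (Φ (P.toFun x))) P.paramDomain := by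
  have h1 : ContDiffOn ℝ 1 (P.normalDeriv i) P.paramDomain :=
    ((P.contDiffOn_normalDeriv i).mono P.paramDomain_subset).of_le (WithTop.coe_le_coe.2 le_top)
  exact ((op.toContinuousBilinearMap.contDiff.comp_contDiffOn h1).clm_apply hΦ)

omit [FiniteDimensional ℝ W] in
theorem continuousOn_formDensity (op : E3 →ₗ[ℝ] V →ₗ[ℝ] W) {Φ : E3 → V}
    (hΦ : ContDiffOn ℝ 1 (fun x => Φ (P.toFun x)) P.paramDomain) :
    ContinuousOn (P.formDensity op Φ) P.paramDomain := by
  have h1 : ∀ i, ContinuousOn (P.normalDeriv i) P.paramDomain := fun i =>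
    (P.contDiffOn_normalDeriv i).continuousOn.mono P.paramDomain_subset
  have h2 : ∀ i j, ContinuousOn
      (fun x => op.toContinuousBilinearMap (P.normalDeriv i x) (P.fieldDeriv Φ j x)) P.paramDomain :=
    fun i j => (op.toContinuousBilinearMap.continuous.comp_continuousOn (h1 i)).clm_apply
      (continuousOn_fieldDeriv hΦ j)
  exact (h2 0 1).sub (h2 1 0)

omit [FiniteDimensional ℝ W] in
theorem fderivWithin_op (op : E3 →ₗ[ℝ] V →ₗ[ℝ] W) {Φ : E3 → V}
    (hΦ : ContDiffOn ℝ 1 (fun x => Φ (P.toFun x)) P.paramDomain) (i j : Fin 2) {x : E2}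
    (hx : x ∈ P.paramDomain) :
    fderivWithin ℝ (fun x => op (P.normalDeriv i x) (Φ (P.toFun x))) P.paramDomain x (e j) =
      op (P.normalDeriv i x) (P.fieldDeriv Φ j x) +
        op (fderiv ℝ (P.normalDeriv i) x (e j)) (Φ (P.toFun x)) := by
  have hu := P.uniqueDiffOn_paramDomain x hx
  have h1 : DifferentiableAt ℝ (P.normalDeriv i) x :=
    ((P.contDiffOn_normalDeriv i).contDiffAt (P.isOpen_immersionDomain.mem_nhds
      (P.paramDomain_subset hx))).differentiableAt (by simp)
  have := op.toContinuousBilinearMap.fderivWithin_of_bilinear h1.differentiableWithinAt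
    (hΦ.differentiableOn one_ne_zero x hx) hu
  simp only [LinearMap.toContinuousBilinearMap_apply] at this
  rw [this, fderivWithin_eq_fderiv hu h1]
  rfl

omit [FiniteDimensional ℝ V] [FiniteDimensional ℝ W] in
-- Moves a compact support from the surface to the parameter domain.
theorem formDensity_eq_zero {C : Set E3} (hC : IsCompact C) (hCS : C ⊆ S ∩ P.target)
    {Φ : E3 → V} (h0 : ∀ p ∈ S \ C, Φ p = 0) (op : E3 →ₗ[ℝ] V →ₗ[ℝ] W) :
    IsCompact (P.coords '' C) ∧ P.coords '' C ⊆ P.paramDomain ∧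
      (∀ x ∈ P.paramDomain \ P.coords '' C, Φ (P.toFun x) = 0) ∧
      ∀ x ∈ P.paramDomain \ P.coords '' C, P.formDensity op Φ x = 0 := by
  have hK : IsCompact (P.coords '' C) := hC.image_of_continuousOn (P.continuousOn_coords.mono hCS)
  have hKD : P.coords '' C ⊆ P.paramDomain := by
    rintro _ ⟨p, hp, rfl⟩; exact coords_mem (hCS hp)
  have hz : ∀ x ∈ P.paramDomain \ P.coords '' C, Φ (P.toFun x) = 0 := fun x hx =>
    h0 _ ⟨(toFun_mem hx.1).1, fun hmem => hx.2 ⟨_, hmem, P.coords_toFun x hx.1⟩⟩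
  refine ⟨hK, hKD, hz, fun x hx => ?_⟩
  have hd : fderivWithin ℝ (fun y => Φ (P.toFun y)) (P.dom ∩ halfPlane) x = 0 :=
    fderivWithin_eq_zero_off_compact hK hz hx
  simp [formDensity, fieldDeriv, hd]

omit [FiniteDimensional ℝ W] in
theorem integrableOn_formDensity {C : Set E3} (hC : IsCompact C) (hCS : C ⊆ S ∩ P.target)
    {Φ : E3 → V} (h0 : ∀ p ∈ S \ C, Φ p = 0) (op : E3 →ₗ[ℝ] V →ₗ[ℝ] W)
    (hΦ : ContDiffOn ℝ 1 (fun x => Φ (P.toFun x)) P.paramDomain) :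
    IntegrableOn (P.formDensity op Φ) P.paramDomain := by
  obtain ⟨hK, hKD, -, hz⟩ := formDensity_eq_zero hC hCS h0 op
  exact integrableOn_of_eq_zero_off_compact hK hKD P.measurableSet_paramDomain
    (continuousOn_formDensity op hΦ) hz

variable (P) in
/-- The parameters of the boundary points covered by a chart. -/
def boundaryDomain : Set ℝ := {t | t • e 0 ∈ P.dom}

theorem isOpen_boundaryDomain : IsOpen P.boundaryDomain :=
  P.isOpen_dom.preimage (by fun_prop : Continuous fun t : ℝ => t • e 0)

theorem smul_e_mem {t : ℝ} (ht : t ∈ P.boundaryDomain) : t • e 0 ∈ P.paramDomain :=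
  ⟨ht, by simp [halfPlane]⟩

omit [FiniteDimensional ℝ W] in
theorem integrableOn_boundary_op {C : Set E3} (hC : IsCompact C) (hCS : C ⊆ S ∩ P.target)
    {Φ : E3 → V} (h0 : ∀ p ∈ S \ C, Φ p = 0) (op : E3 →ₗ[ℝ] V →ₗ[ℝ] W)
    (hΦ : ContDiffOn ℝ 1 (fun x => Φ (P.toFun x)) P.paramDomain) :
    IntegrableOn (fun t : ℝ => op (P.normalDeriv 0 (t • e 0)) (Φ (P.toFun (t • e 0))))
      P.boundaryDomain := by
  obtain ⟨hK, hKD, hz, -⟩ := formDensity_eq_zero hC hCS h0 op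
  have hcont : Continuous fun t : ℝ => t • e 0 := by fun_prop
  have hemb : IsClosedEmbedding fun t : ℝ => t • e 0 :=
    isClosedEmbedding_smul_left (by simp)
  refine integrableOn_of_eq_zero_off_compact (hemb.isCompact_preimage hK)
    (fun t ht => (hKD ht).1) isOpen_boundaryDomain.measurableSet
    ((contDiffOn_op op hΦ 0).continuousOn.comp hcont.continuousOn fun t ht => smul_e_mem ht)
    fun t ht => ?_
  rw [hz _ ⟨smul_e_mem ht.1, ht.2⟩, map_zero]

/-- Stokes' theorem in a chart. -/
theorem integral_formDensity {C : Set E3} (hC : IsCompact C) (hCS : C ⊆ S ∩ P.target)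
    {Φ : E3 → V} (h0 : ∀ p ∈ S \ C, Φ p = 0) (op : E3 →ₗ[ℝ] V →ₗ[ℝ] W)
    (hΦ : ContDiffOn ℝ 1 (fun x => Φ (P.toFun x)) P.paramDomain) :
    ∫ x in P.paramDomain, P.formDensity op Φ x =
      -∫ t in P.boundaryDomain, op (P.normalDeriv 0 (t • e 0)) (Φ (P.toFun (t • e 0))) := by
  have : CompleteSpace W := FiniteDimensional.complete ℝ W
  obtain ⟨hK, hKD, hz, -⟩ := formDensity_eq_zero hC hCS h0 op
  -- The divergence of `(-∂₁n ∘ Φ, ∂₀n ∘ Φ)` is `formDensity`, because the terms with second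
  -- derivatives of `n` cancel.
  have hdiv := integral_divergence_halfPlane (G₀ := fun x => -op (P.normalDeriv 1 x) (Φ (P.toFun x)))
    (G₁ := fun x => op (P.normalDeriv 0 x) (Φ (P.toFun x))) P.isOpen_dom hK hKD
    (fun x hx => by rw [hz x hx, map_zero, neg_zero]) (fun x hx => by rw [hz x hx, map_zero])
    (contDiffOn_op op hΦ 1).neg (contDiffOn_op op hΦ 0)
  refine Eq.trans (setIntegral_congr_fun P.measurableSet_paramDomain fun x hx => ?_) hdiv
  have hu := P.uniqueDiffOn_paramDomain x hx
  change _ = fderivWithin ℝ (-fun x => op (P.normalDeriv 1 x) (Φ (P.toFun x))) P.paramDomain x (e 0) +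
    fderivWithin ℝ (fun x => op (P.normalDeriv 0 x) (Φ (P.toFun x))) P.paramDomain x (e 1)
  rw [fderivWithin_neg hu, neg_apply, fderivWithin_op op hΦ 1 0 hx,
    fderivWithin_op op hΦ 0 1 hx, formDensity]
  have hsymm : fderiv ℝ (P.normalDeriv 0) x (e 1) = fderiv ℝ (P.normalDeriv 1) x (e 0) :=
    fderiv_fderiv_symm P.isOpen_immersionDomain P.contDiffOn_unitNormal (P.paramDomain_subset hx) _ _
  rw [hsymm]
  abel

end LocalParam

/-! ### Surface area and arc length in a chart -/

namespace LocalParam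

variable {S : Set E3} (P : LocalParam S) {W : Type*} [NormedAddCommGroup W] [NormedSpace ℝ W]

/-- The square of `normDet` is the Gram determinant, here `det g`, which is `|g₀ × g₁|²` by
Lagrange's identity. -/
theorem normDet_fderiv {x : E2} :
    (fderiv ℝ P.toFun x : E2 →ₗ[ℝ] E3).normDet = P.areaDensity x := by
  refine (sq_eq_sq₀ (LinearMap.normDet_nonneg _) (norm_nonneg _)).1 ?_
  have h := LinearMap.normDet_sq_eq_det_gram (fderiv ℝ P.toFun x : E2 →ₗ[ℝ] E3)
    (EuclideanSpace.basisFun (Fin 2) ℝ)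
  have h2 := P.det_metric x
  simp only [RCLike.ofReal_real_eq_id, id_eq] at h
  rw [h]
  refine Eq.trans (congrArg Matrix.det ?_) h2
  ext i j
  simp [Matrix.gram, metric, tangent]

theorem integrableOn_inter_target_iff (g : E3 → W) :
    IntegrableOn g (S ∩ P.target) μHE[2] ↔
      IntegrableOn (fun x => P.areaDensity x • g (P.toFun x)) P.paramDomain := by
  have h := integrableOn_image_iff P.measurableSet_paramDomain
    (fun x hx => P.hasStrictFDerivAt_toFun hx.1) (fun x hx => P.injective_fderiv hx) P.injOn_toFun
    (fun x _ => P.normDet_fderiv) (P.contDiffOn_areaDensity.continuousOn.mono P.paramDomain_subset) g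
  rwa [finrank_euclideanSpace_fin, paramDomain, P.image_eq] at h

theorem setIntegral_inter_target (g : E3 → W) :
    ∫ p in S ∩ P.target, g p ∂μHE[2] = ∫ x in P.paramDomain, P.areaDensity x • g (P.toFun x) := by
  have h := setIntegral_image_eq P.measurableSet_paramDomain
    (fun x hx => P.hasStrictFDerivAt_toFun hx.1) (fun x hx => P.injective_fderiv hx) P.injOn_toFun
    (fun x _ => P.normDet_fderiv) (P.contDiffOn_areaDensity.continuousOn.mono P.paramDomain_subset) g
  rwa [finrank_euclideanSpace_fin, paramDomain, P.image_eq] at h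

/-- The parametrization of the boundary curve by the first coordinate. -/
def boundaryCurve (t : ℝ) : E3 := P.toFun (t • e 0)

/-- The velocity of the boundary curve, as a linear map. -/
def boundaryDeriv (t : ℝ) : ℝ →L[ℝ] E3 := ContinuousLinearMap.toSpanSingleton ℝ (P.tangent 0 (t • e 0))

variable {P} in
theorem hasStrictFDerivAt_boundaryCurve {t : ℝ} (ht : t ∈ P.boundaryDomain) :
    HasStrictFDerivAt P.boundaryCurve (P.boundaryDeriv t) t := by
  have h1 := (ContinuousLinearMap.toSpanSingleton ℝ (e 0)).hasStrictFDerivAt (x := t)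
  have h2 := (P.hasStrictFDerivAt_toFun (smul_e_mem ht).1).comp t h1
  have heq : P.boundaryDeriv t =
      fderiv ℝ P.toFun (t • e 0) ∘L ContinuousLinearMap.toSpanSingleton ℝ (e 0) := by
    ext1
    simp [boundaryDeriv, tangent]
  rw [heq]
  exact h2

variable {P} in
theorem tangent_zero_ne_zero {x : E2} (hx : x ∈ P.paramDomain) : P.tangent 0 x ≠ 0 := fun h => by
  have := P.injective_fderiv hx (a₁ := e 0) (a₂ := 0) (by rw [map_zero]; exact h)
  simpa using congrArg (fun v : E2 => v 0) this

variable {P} in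
theorem injective_boundaryDeriv {t : ℝ} (ht : t ∈ P.boundaryDomain) :
    Function.Injective (P.boundaryDeriv t) :=
  smul_left_injective ℝ (tangent_zero_ne_zero (smul_e_mem ht))

theorem normDet_boundaryDeriv (t : ℝ) :
    (P.boundaryDeriv t : ℝ →ₗ[ℝ] E3).normDet = ‖P.tangent 0 (t • e 0)‖ := by
  refine (sq_eq_sq₀ (LinearMap.normDet_nonneg _) (norm_nonneg _)).1 ?_
  have h := LinearMap.normDet_sq_eq_det_gram (P.boundaryDeriv t : ℝ →ₗ[ℝ] E3)
    (OrthonormalBasis.singleton (Fin 1) ℝ)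
  simp only [RCLike.ofReal_real_eq_id, id_eq] at h
  rw [h]
  simp [Matrix.gram, boundaryDeriv]

theorem injOn_boundaryCurve : InjOn P.boundaryCurve P.boundaryDomain := fun s hs t ht h => by
  have := P.injOn_toFun (smul_e_mem hs) (smul_e_mem ht) h
  simpa using congrArg (fun v : E2 => v 0) this

theorem continuousOn_norm_tangent :
    ContinuousOn (fun t : ℝ => ‖P.tangent 0 (t • e 0)‖) P.boundaryDomain :=
  ((P.contDiffOn_tangent 0).continuousOn.comp
    (by fun_prop : Continuous fun t : ℝ => t • e 0).continuousOn fun _ ht => ht).norm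

theorem image_boundaryCurve :
    P.boundaryCurve '' P.boundaryDomain = {p | p ∈ S ∩ P.target ∧ P.coords p 1 = 0} := by
  ext p
  constructor
  · rintro ⟨t, ht, rfl⟩
    refine ⟨toFun_mem (smul_e_mem ht), ?_⟩
    rw [boundaryCurve, P.coords_toFun _ (smul_e_mem ht)]
    simp
  · rintro ⟨hp, h0⟩
    have hc : P.coords p 0 • e 0 = P.coords p := by
      conv_rhs => rw [eq_sum_e (P.coords p), h0, zero_smul, add_zero]
    refine ⟨P.coords p 0, ?_, ?_⟩
    · change _ ∈ P.dom
      rw [hc]; exact (coords_mem hp).1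
    · rw [boundaryCurve, hc, toFun_coords hp]

theorem measurableSet_image_boundaryCurve :
    MeasurableSet (P.boundaryCurve '' P.boundaryDomain) :=
  isOpen_boundaryDomain.measurableSet.image_of_continuousOn_injOn
    (fun _ ht => (hasStrictFDerivAt_boundaryCurve ht).hasFDerivAt.continuousAt.continuousWithinAt)
    P.injOn_boundaryCurve

theorem integrableOn_boundaryCurve_iff (g : E3 → W) :
    IntegrableOn g (P.boundaryCurve '' P.boundaryDomain) μHE[1] ↔
      IntegrableOn (fun t : ℝ => ‖P.tangent 0 (t • e 0)‖ • g (P.boundaryCurve t))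
        P.boundaryDomain := by
  have h := integrableOn_image_iff isOpen_boundaryDomain.measurableSet
    (fun t ht => hasStrictFDerivAt_boundaryCurve ht) (fun t ht => injective_boundaryDeriv ht)
    P.injOn_boundaryCurve (fun t _ => P.normDet_boundaryDeriv t) P.continuousOn_norm_tangent g
  rwa [finrank_self] at h

theorem setIntegral_boundaryCurve (g : E3 → W) :
    ∫ p in P.boundaryCurve '' P.boundaryDomain, g p ∂μHE[1] =
      ∫ t in P.boundaryDomain, ‖P.tangent 0 (t • e 0)‖ • g (P.boundaryCurve t) := by
  have h := setIntegral_image_eq isOpen_boundaryDomain.measurableSet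
    (fun t ht => hasStrictFDerivAt_boundaryCurve ht) (fun t ht => injective_boundaryDeriv ht)
    P.injOn_boundaryCurve (fun t _ => P.normDet_boundaryDeriv t) P.continuousOn_norm_tangent g
  rwa [finrank_self] at h

end LocalParam

/-! ### From charts to the whole surface -/

namespace OrientedSurface

open LocalParam

variable {S : OrientedSurface} {V W : Type*} [NormedAddCommGroup V] [NormedSpace ℝ V]
  [NormedAddCommGroup W] [NormedSpace ℝ W]

theorem mem_carrier_target {p : E3} (hp : p ∈ S.carrier) :
    p ∈ S.carrier ∩ (S.paramAt p).target := ⟨hp, S.mem_target p hp⟩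

theorem pt_mem {p : E3} (hp : p ∈ S.carrier) : S.pt p ∈ (S.paramAt p).paramDomain :=
  coords_mem (mem_carrier_target hp)

theorem toFun_pt {p : E3} (hp : p ∈ S.carrier) : (S.paramAt p).toFun (S.pt p) = p :=
  toFun_coords (mem_carrier_target hp)

theorem hasNormal {p : E3} (hp : p ∈ S.carrier) : (S.paramAt p).HasNormal S.normal :=
  S.oriented p hp

theorem exists_isTransition {p q : E3} (hp : p ∈ S.carrier) (hpq : p ∈ (S.paramAt q).target) :
    ∃ A, IsTransition (S.paramAt p) (S.paramAt q) (S.pt p) A :=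
  LocalParam.exists_isTransition _ _ (pt_mem hp) (by rw [toFun_pt hp]; exact hpq)

theorem normalCrossGrad_eq_formDensity (hK : S.CurvatureNonsingular) (op : E3 →ₗ[ℝ] V →ₗ[ℝ] W)
    (Φ : E3 → V) {p : E3} (hp : p ∈ S.carrier) :
    S.normalCrossGrad op Φ p = ((S.paramAt p).areaDensity (S.pt p))⁻¹ •
      (S.paramAt p).formDensity op Φ (S.pt p) :=
  LocalParam.normalCrossGrad_eq _ op Φ ((S.paramAt p).paramDomain_subset (pt_mem hp)) (hK p hp)

/-- Replaces the chart chosen at `p`, which changes with the point of integration, by one fixed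
chart. -/
theorem normalCrossGrad_eq_of_mem_target (hK : S.CurvatureNonsingular) (op : E3 →ₗ[ℝ] V →ₗ[ℝ] W)
    {Φ : E3 → V} (hΦ : S.ContDiffField Φ) {p q : E3} (hp : p ∈ S.carrier) (hq : q ∈ S.carrier)
    (hpq : p ∈ (S.paramAt q).target) :
    S.normalCrossGrad op Φ p = ((S.paramAt q).areaDensity ((S.paramAt q).coords p))⁻¹ •
      (S.paramAt q).formDensity op Φ ((S.paramAt q).coords p) := by
  obtain ⟨A, hA⟩ := exists_isTransition hp hpq
  rw [normalCrossGrad_eq_formDensity hK op Φ hp, hA.formDensity_eq (hasNormal hp) (hasNormal hq) op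
    ((hΦ q hq).differentiableOn one_ne_zero _ hA.coords_mem), toFun_pt hp]

theorem curvatureTensor_boundaryTangent {p : E3} (hp : p ∈ S.carrier) :
    S.curvatureTensor p (S.boundaryTangent p) =
      -(‖(S.paramAt p).tangent 0 (S.pt p)‖⁻¹ • (S.paramAt p).normalDeriv 0 (S.pt p)) := by
  rw [curvatureTensor, boundaryTangent, map_smul,
    curvatureTensor_tangent _ ((S.paramAt p).paramDomain_subset (pt_mem hp)), smul_neg]

theorem curvatureTensor_boundaryTangent_of_mem_target {p q : E3} (hp : p ∈ S.carrier)
    (hq : q ∈ S.carrier) (hpq : p ∈ (S.paramAt q).target) (h0 : (S.paramAt q).coords p 1 = 0) :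
    S.curvatureTensor p (S.boundaryTangent p) =
      -(‖(S.paramAt q).tangent 0 ((S.paramAt q).coords p)‖⁻¹ •
        (S.paramAt q).normalDeriv 0 ((S.paramAt q).coords p)) := by
  obtain ⟨A, hA⟩ := exists_isTransition hp hpq
  rw [curvatureTensor_boundaryTangent hp, hA.boundary_term_eq (hasNormal hp) (hasNormal hq)
    (by rw [toFun_pt hp]; exact h0), toFun_pt hp]

theorem boundary_inter_target (q : E3) :
    S.boundary ∩ (S.paramAt q).target =
      (S.paramAt q).boundaryCurve '' (S.paramAt q).boundaryDomain := by
  rw [image_boundaryCurve]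
  ext p
  constructor
  · rintro ⟨⟨hp, h0⟩, hpq⟩
    exact ⟨⟨hp, hpq⟩, (coords_boundary_iff (mem_carrier_target hp) ⟨hp, hpq⟩).1 h0⟩
  · rintro ⟨⟨hp, hpq⟩, h0⟩
    exact ⟨⟨hp, (coords_boundary_iff (mem_carrier_target hp) ⟨hp, hpq⟩).2 h0⟩, hpq⟩

theorem measurableSet_boundary (S : OrientedSurface) : MeasurableSet S.boundary := by
  obtain ⟨t, -, ht⟩ := S.isCompact_carrier.elim_nhds_subcover (fun p => (S.paramAt p).target)
    fun p hp => (S.paramAt p).isOpen_target.mem_nhds (S.mem_target p hp)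
  have : S.boundary = ⋃ q ∈ t, S.boundary ∩ (S.paramAt q).target := by
    rw [← inter_iUnion₂, inter_eq_left.2 (Subset.trans (fun p hp => hp.1) ht)]
  rw [this]
  refine t.measurableSet_biUnion fun q _ => ?_
  rw [boundary_inter_target]
  exact measurableSet_image_boundaryCurve _

theorem normalCrossGrad_eq_zero (hK : S.CurvatureNonsingular) (op : E3 →ₗ[ℝ] V →ₗ[ℝ] W)
    {Φ : E3 → V} {C : Set E3} (hC : IsClosed C) (h0 : ∀ p ∈ S.carrier \ C, Φ p = 0) {p : E3}
    (hp : p ∈ S.carrier \ C) : S.normalCrossGrad op Φ p = 0 := by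
  have hev : (fun x => Φ ((S.paramAt p).toFun x)) =ᶠ[𝓝[(S.paramAt p).paramDomain] S.pt p]
      fun _ => 0 := by
    filter_upwards [(tendsto_toFun _ (pt_mem hp.1)).eventually (inter_mem self_mem_nhdsWithin
      (mem_nhdsWithin_of_mem_nhds (hC.isOpen_compl.mem_nhds (by rw [toFun_pt hp.1]; exact hp.2))))]
      with x hx using h0 _ hx
  have hd : fderivWithin ℝ (fun x => Φ ((S.paramAt p).toFun x)) ((S.paramAt p).dom ∩ halfPlane)
      (S.pt p) = 0 := by
    refine (hev.fderivWithin_eq (by rw [toFun_pt hp.1]; exact h0 p hp)).trans ?_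
    simp
  rw [normalCrossGrad_eq_formDensity hK op Φ hp.1, formDensity]
  simp [fieldDeriv, hd]

variable [FiniteDimensional ℝ V] [FiniteDimensional ℝ W]

/-- The theorem for fields supported in the range of a chart. -/
theorem stokes_of_support (hK : S.CurvatureNonsingular) (op : E3 →ₗ[ℝ] V →ₗ[ℝ] W)
    {Φ : E3 → V} (hΦ : S.ContDiffField Φ) {C : Set E3} (hC : IsCompact C) {q : E3}
    (hq : q ∈ S.carrier) (hCS : C ⊆ S.carrier ∩ (S.paramAt q).target)
    (h0 : ∀ p ∈ S.carrier \ C, Φ p = 0) :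
    IntegrableOn (fun p => op (S.curvatureTensor p (S.boundaryTangent p)) (Φ p)) S.boundary μHE[1] ∧
    IntegrableOn (fun p => S.normalCrossGrad op Φ p) S.carrier μHE[2] ∧
    ∫ p in S.boundary, op (S.curvatureTensor p (S.boundaryTangent p)) (Φ p) ∂μHE[1] =
      ∫ p in S.carrier, S.normalCrossGrad op Φ p ∂μHE[2] := by
  set Q := S.paramAt q with hQ
  -- The area density from the change of variables cancels the one in `normalCrossGrad`; in `hlen`
  -- below, `|g₀|` cancels the normalization of `τ`.
  have harea : ∀ x ∈ Q.paramDomain,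
      Q.areaDensity x • S.normalCrossGrad op Φ (Q.toFun x) = Q.formDensity op Φ x := fun x hx => by
    have hmem := toFun_mem hx
    rw [normalCrossGrad_eq_of_mem_target hK op hΦ hmem.1 hq hmem.2, ← hQ, Q.coords_toFun x hx,
      smul_inv_smul₀ (Q.areaDensity_pos (Q.paramDomain_subset hx)).ne']
  have hlen : ∀ t ∈ Q.boundaryDomain,
      ‖Q.tangent 0 (t • e 0)‖ • op (S.curvatureTensor (Q.boundaryCurve t)
        (S.boundaryTangent (Q.boundaryCurve t))) (Φ (Q.boundaryCurve t)) =
      -op (Q.normalDeriv 0 (t • e 0)) (Φ (Q.toFun (t • e 0))) := fun t ht => by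
    have hmem := toFun_mem (smul_e_mem ht)
    have hc := Q.coords_toFun _ (smul_e_mem ht)
    rw [boundaryCurve, curvatureTensor_boundaryTangent_of_mem_target hmem.1 hq hmem.2
      (by rw [← hQ, hc]; simp), ← hQ, hc, map_neg, map_smul, LinearMap.neg_apply,
      LinearMap.smul_apply, smul_neg,
      smul_inv_smul₀ (norm_ne_zero_iff.2 (tangent_zero_ne_zero (smul_e_mem ht)))]
  have hcarrier : MeasurableSet S.carrier := S.isCompact_carrier.isClosed.measurableSet
  have hz2 : ∀ p ∈ S.carrier \ (S.carrier ∩ Q.target), S.normalCrossGrad op Φ p = 0 := fun p hp =>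
    normalCrossGrad_eq_zero hK op hC.isClosed h0 ⟨hp.1, fun h => hp.2 (hCS h)⟩
  have hz1 : ∀ p ∈ S.boundary \ (S.boundary ∩ Q.target),
      op (S.curvatureTensor p (S.boundaryTangent p)) (Φ p) = 0 := fun p hp => by
    rw [h0 p ⟨hp.1.1, fun h => hp.2 ⟨hp.1, (hCS h).2⟩⟩, map_zero]
  refine ⟨IntegrableOn.of_forall_sdiff_eq_zero ?_ S.measurableSet_boundary hz1,
    IntegrableOn.of_forall_sdiff_eq_zero ?_ hcarrier hz2, ?_⟩
  · rw [hQ, boundary_inter_target, integrableOn_boundaryCurve_iff,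
      integrableOn_congr_fun hlen isOpen_boundaryDomain.measurableSet]
    exact (integrableOn_boundary_op hC hCS h0 op (hΦ q hq)).neg
  · rw [integrableOn_inter_target_iff, integrableOn_congr_fun harea Q.measurableSet_paramDomain]
    exact integrableOn_formDensity hC hCS h0 op (hΦ q hq)
  · rw [setIntegral_eq_of_subset_of_forall_sdiff_eq_zero S.measurableSet_boundary inter_subset_left hz1,
      setIntegral_eq_of_subset_of_forall_sdiff_eq_zero hcarrier inter_subset_left hz2,
      hQ, boundary_inter_target, setIntegral_boundaryCurve, setIntegral_inter_target,
      setIntegral_congr_fun isOpen_boundaryDomain.measurableSet hlen,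
      setIntegral_congr_fun Q.measurableSet_paramDomain harea,
      integral_formDensity hC hCS h0 op (hΦ q hq), integral_neg]

omit [FiniteDimensional ℝ V] in
theorem ContDiffField.smul {Φ : E3 → V} (hΦ : S.ContDiffField Φ) {φ : E3 → ℝ}
    (hφ : ContDiff ℝ ∞ φ) : S.ContDiffField fun p => φ p • Φ p := fun p hp => by
  have h1 : ContDiffOn ℝ ∞ (fun x => φ ((S.paramAt p).toFun x)) ((S.paramAt p).dom ∩ halfPlane) :=
    hφ.comp_contDiffOn ((S.paramAt p).smooth.mono inter_subset_left)
  exact (h1.of_le (WithTop.coe_le_coe.2 le_top)).smul (hΦ p hp)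

omit [FiniteDimensional ℝ V] [FiniteDimensional ℝ W] in
theorem normalCrossGrad_sum (op : E3 →ₗ[ℝ] V →ₗ[ℝ] W) {ι : Type*} (I : Finset ι) {Φ : E3 → V}
    {Ψ : ι → E3 → V} (hΨ : ∀ i, S.ContDiffField (Ψ i))
    (hsum : ∀ p ∈ S.carrier, Φ p = ∑ i ∈ I, Ψ i p) {p : E3} (hp : p ∈ S.carrier) :
    S.normalCrossGrad op Φ p = ∑ i ∈ I, S.normalCrossGrad op (Ψ i) p := by
  have hd : ∀ j, (S.paramAt p).fieldDeriv Φ j (S.pt p) =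
      ∑ i ∈ I, (S.paramAt p).fieldDeriv (Ψ i) j (S.pt p) := fun j => by
    have h1 : fderivWithin ℝ (fun x => Φ ((S.paramAt p).toFun x)) (S.paramAt p).paramDomain (S.pt p) =
        ∑ i ∈ I, fderivWithin ℝ (fun x => Ψ i ((S.paramAt p).toFun x)) (S.paramAt p).paramDomain
          (S.pt p) := by
      rw [fderivWithin_congr (fun x hx => hsum _ (toFun_mem hx).1) (hsum _ (toFun_mem (pt_mem hp)).1),
        fderivWithin_fun_sum ((S.paramAt p).uniqueDiffOn_paramDomain _ (pt_mem hp))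
          fun i _ => (hΨ i p hp).differentiableOn one_ne_zero _ (pt_mem hp)]
    simp only [fieldDeriv]
    change fderivWithin ℝ _ (S.paramAt p).paramDomain _ _ = _
    rw [h1, sum_apply]
    rfl
  simp only [normalCrossGrad, LocalParam.normalCrossGrad, hd, map_sum, Finset.smul_sum,
    Fin.sum_univ_two, Finset.sum_add_distrib]

/-- The functions are indexed by all points of the surface; by local finiteness and compactness only
finitely many supports meet it, so the sums are finite. -/
theorem exists_partition (S : OrientedSurface) :
    ∃ (I : Finset S.carrier) (φ : S.carrier → E3 → ℝ), (∀ i, ContDiff ℝ ∞ (φ i)) ∧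
      (∀ i, tsupport (φ i) ⊆ (S.paramAt i).target) ∧ ∀ p ∈ S.carrier, ∑ i ∈ I, φ i p = 1 := by
  obtain ⟨φ, hφ⟩ := SmoothPartitionOfUnity.exists_isSubordinate (modelWithCornersSelf ℝ E3)
    S.isCompact_carrier.isClosed (fun i : S.carrier => (S.paramAt i).target)
    (fun i => (S.paramAt i).isOpen_target)
    (fun p hp => mem_iUnion.2 ⟨⟨p, hp⟩, S.mem_target p hp⟩)
  have hfin := φ.locallyFinite.finite_nonempty_inter_compact S.isCompact_carrier
  refine ⟨hfin.toFinset, fun i => φ i, fun i => (φ i).contMDiff.contDiff, hφ, fun p hp => ?_⟩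
  rw [← φ.sum_eq_one hp, finsum_eq_sum_of_support_subset]
  intro i hi
  simp only [Finite.coe_toFinset]
  exact ⟨p, hi, hp⟩

end OrientedSurface

end SurfaceCalculus

end

theorem proposition3
    {V W : Type*} [NormedAddCommGroup V] [NormedSpace ℝ V] [FiniteDimensional ℝ V]
    [NormedAddCommGroup W] [NormedSpace ℝ W] [FiniteDimensional ℝ W]
    (S : SurfaceCalculus.OrientedSurface) (hK : S.CurvatureNonsingular)
    (op : SurfaceCalculus.E3 →ₗ[ℝ] V →ₗ[ℝ] W)
    (Φ : SurfaceCalculus.E3 → V) (hΦ : S.ContDiffField Φ) :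
    IntegrableOn (fun p => op (S.curvatureTensor p (S.boundaryTangent p)) (Φ p))
      S.boundary (Measure.euclideanHausdorffMeasure 1) ∧
    IntegrableOn (fun p => S.normalCrossGrad op Φ p)
      S.carrier (Measure.euclideanHausdorffMeasure 2) ∧
    ∫ p in S.boundary, op (S.curvatureTensor p (S.boundaryTangent p)) (Φ p)
        ∂(Measure.euclideanHausdorffMeasure 1) =
      ∫ p in S.carrier, S.normalCrossGrad op Φ p ∂(Measure.euclideanHausdorffMeasure 2) := by
  obtain ⟨I, φ, hφ, hsupp, hone⟩ := S.exists_partition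
  have hsm : ∀ i, S.ContDiffField fun p => φ i p • Φ p := fun i => hΦ.smul (hφ i)
  have hsum : ∀ p ∈ S.carrier, Φ p = ∑ i ∈ I, φ i p • Φ p := fun p hp => by
    rw [← Finset.sum_smul, hone p hp, one_smul]
  -- Each `φ i • Φ` vanishes on the surface off `S.carrier ∩ tsupport (φ i)`, a compact set inside
  -- the range of one chart; both integrands are linear in the field, so the pieces add up.
  have hst := fun i : S.carrier => SurfaceCalculus.OrientedSurface.stokes_of_support hK op (hsm i)
    (S.isCompact_carrier.inter_right (isClosed_tsupport (φ i))) i.2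
    (Set.inter_subset_inter_right _ (hsupp i)) fun p hp => by
      rw [image_eq_zero_of_notMem_tsupport fun h => hp.2 ⟨hp.1, h⟩, zero_smul]
  have hcarrier : MeasurableSet S.carrier := S.isCompact_carrier.isClosed.measurableSet
  have h2 : Set.EqOn (fun p => S.normalCrossGrad op Φ p)
      (fun p => ∑ i ∈ I, S.normalCrossGrad op (fun p => φ i p • Φ p) p) S.carrier :=
    fun p hp => SurfaceCalculus.OrientedSurface.normalCrossGrad_sum op I hsm hsum hp
  have h1 : Set.EqOn (fun p => op (S.curvatureTensor p (S.boundaryTangent p)) (Φ p))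
      (fun p => ∑ i ∈ I, op (S.curvatureTensor p (S.boundaryTangent p)) (φ i p • Φ p))
      S.boundary := fun p hp => by
    simp only
    rw [← map_sum, ← hsum p hp.1]
  rw [integrableOn_congr_fun h1 S.measurableSet_boundary, integrableOn_congr_fun h2 hcarrier,
    setIntegral_congr_fun S.measurableSet_boundary h1, setIntegral_congr_fun hcarrier h2,
    integral_finsetSum _ fun i _ => (hst i).1, integral_finsetSum _ fun i _ => (hst i).2.1]
  exact ⟨integrable_finsetSum _ fun i _ => (hst i).1, integrable_finsetSum _ fun i _ => (hst i).2.1,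
    Finset.sum_congr rfl fun i _ => (hst i).2.2⟩
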